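/- Let $n\ge 1$, $\beta\in(0,\tfrac12)$, and let $f\in W^{\beta,2}(\mathbb R^n)$ be non-negative and not almost everywhere zero, where $$W^{\beta,2}(\mathbb R^n)=\Big\{f\in L^2(\mathbb R^n):\int_{\mathbb R^n}\int_{\mathbb R^n}\frac{|f(x)-f(y)|^2}{|x-y|^{n+2\beta}}\,dx\,dy<\infty\Big\}.$$ Let $\mathrm R_0f\subset\mathbb R^n$ be the star-shaped set whose radial function $\rho_{\mathrm R_0f}(u)=\sup\{r\ge 0: ru\in \mathrm R_0f\}\in[0,\infty]$, $u\in\mathbb S^{n-1}$, is given by $$\log\rho_{\mathrm R_0f}(u)=-\gamma+\int_0^\infty\frac1t\Big(\frac1{\|f\|_2^2}\int_{\mathbb R^n}f(x)f(x+tu)\,dx-e^{-t}\Big)dt ,$$ where $\gamma$ is the Euler constant. Let $\hat f$ be the $L^2$ Fourier transform extending $\hat f(\xi)=\int_{\mathbb R^n}e^{-2\pi i\xi\cdot x}f(x)\,dx$, let $\omega_n$ be the volume of the unit ball of $\mathbb R^n$, let $du$ be the spherical Lebesgue measure, and let $\psi=\Gamma'/\Gamma$. Integrals are taken in $[-\infty,\infty]$.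 Then the integral defining $\log\rho_{\mathrm R_0f}(u)$ exists for almost all $u$, the integrals $\int_{\mathbb S^{n-1}}\log\rho_{\mathrm R_0f}(u)\,du$ and $\int_{\mathbb R^n}|\hat f(\xi)|^2\log|\xi|\,d\xi$ exist, the latter is less than $+\infty$, and $$-\frac1{n\omega_n}\int_{\mathbb S^{n-1}}\log\rho_{\mathrm R_0f}(u)\,du=\frac1{\|f\|_2^2}\int_{\mathbb R^n}|\hat f(\xi)|^2\log|\xi|\,d\xi+\log\pi-\frac12\Big(\psi\big(\tfrac n2\big)+\psi(1)\Big),$$ as an identity in $[-\infty,\infty)$. In particular, the factor $1/\|f\|_2^2$ disappears when $\|f\|_2=1$. -/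

import Mathlib

open MeasureTheory Set
open scoped ENNReal NNReal FourierTransform

noncomputable section

namespace RadialMean

/-- The fractional Sobolev space `W^{β,2}(ℝⁿ)`: square integrable functions with finite
Gagliardo double integral. -/
structure MemFracSobolev {n : ℕ} (β : ℝ) (f : EuclideanSpace ℝ (Fin n) → ℝ) : Prop where
  memLp : MemLp f 2 volume
  gagliardo_lt_top :
    ∫⁻ x : EuclideanSpace ℝ (Fin n), ∫⁻ y : EuclideanSpace ℝ (Fin n),
      ENNReal.ofReal (|f x - f y| ^ 2 / ‖x - y‖ ^ ((n : ℝ) + 2 * β)) < ⊤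

/-- The Lebesgue integral of an extended real valued function, with values in `[-∞, ∞]`:
integral of the positive part minus integral of the negative part.
It is meaningful when `IntegralExists h μ` holds. -/
def extIntegral {α : Type*} [MeasurableSpace α] (μ : Measure α) (h : α → EReal) : EReal :=
  ((∫⁻ x, (h x).toENNReal ∂μ : ℝ≥0∞) : EReal) - ((∫⁻ x, (-h x).toENNReal ∂μ : ℝ≥0∞) : EReal)

/-- The integral of `h` exists in `[-∞, ∞]`: `h` is a.e.-measurable and its positive and negative
parts do not both have infinite integral. -/
def IntegralExists {α : Type*} [MeasurableSpace α] (μ : Measure α) (h : α → EReal) : Prop :=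
  AEMeasurable h μ ∧
    ((∫⁻ x, (h x).toENNReal ∂μ) < ⊤ ∨ (∫⁻ x, (-h x).toENNReal ∂μ) < ⊤)

/-- `‖f‖₂²`. -/
def l2NormSq {n : ℕ} (f : EuclideanSpace ℝ (Fin n) → ℝ) : ℝ := ∫ x, f x ^ 2

/-- The integrand `t⁻¹ (‖f‖₂⁻² ∫ f(x) f(x + t u) dx - e^{-t})`. -/
def radialMeanIntegrand {n : ℕ} (f : EuclideanSpace ℝ (Fin n) → ℝ)
    (u : EuclideanSpace ℝ (Fin n)) (t : ℝ) : ℝ :=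
  1 / t * (1 / l2NormSq f * (∫ x, f x * f (x + t • u)) - Real.exp (-t))

/-- `log ρ(u) = -γ + ∫₀^∞ t⁻¹ (‖f‖₂⁻² ∫ f(x) f(x + t u) dx - e^{-t}) dt` in `[-∞, ∞]`, for a unit
vector `u`. -/
def radialMeanLog {n : ℕ} (f : EuclideanSpace ℝ (Fin n) → ℝ)
    (u : EuclideanSpace ℝ (Fin n)) : EReal :=
  ((-Real.eulerMascheroniConstant : ℝ) : EReal) +
    extIntegral (volume.restrict (Ioi (0 : ℝ))) (fun t => (radialMeanIntegrand f u t : EReal))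

/-- The radial mean body `R₀ f`: the star-shaped set whose radius in the direction of the unit
vector `u` is `exp (radialMeanLog f u) ∈ [0, ∞]`. -/
def radialMeanBody {n : ℕ} (f : EuclideanSpace ℝ (Fin n) → ℝ) : Set (EuclideanSpace ℝ (Fin n)) :=
  {x | x = 0 ∨ ENNReal.ofReal ‖x‖ ≤ EReal.exp (radialMeanLog f (‖x‖⁻¹ • x))}

/-- The radial function `ρ_L(x) = sup {r ≥ 0 : r x ∈ L} ∈ [0, ∞]` of a star-shaped set `L`. -/
def radialFunction {n : ℕ} (L : Set (EuclideanSpace ℝ (Fin n)))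
    (x : EuclideanSpace ℝ (Fin n)) : ℝ≥0∞ :=
  ⨆ (r : ℝ≥0) (_ : (r : ℝ) • x ∈ L), (r : ℝ≥0∞)

/-- The (Plancherel) Fourier transform on `L²(ℝⁿ)` of a real function, which extends
`f̂(ξ) = ∫ e^{-2π i ξ·x} f(x) dx`. -/
def fourierL2 {n : ℕ} (f : EuclideanSpace ℝ (Fin n) → ℝ) (hf : MemLp f 2 volume) :
    Lp (α := EuclideanSpace ℝ (Fin n)) ℂ 2 :=
  𝓕 (MemLp.toLp (fun x => (f x : ℂ)) hf.ofReal)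

/-- The digamma function on the reals, the logarithmic derivative of the Gamma function. -/
def digamma (x : ℝ) : ℝ := logDeriv Real.Gamma x

/-- The volume `ω_n` of the unit ball of `ℝⁿ`. -/
def unitBallVolume (n : ℕ) : ℝ :=
  volume.real (Metric.ball (0 : EuclideanSpace ℝ (Fin n)) 1)

end RadialMean

end

/-! For a function `A` on the half-line with values in [0,1] put J(A) = ∫_1^∞ A(t)/t dt − ∫_0^1 (1 −
A(t))/t dt. Invariance of dt/t under scaling gives J(A(r·)) = J(A) − log r (`upperLog_shift`). The
proof computes J(H) in two ways for one function H.

Let c(z) = ‖f‖₂⁻² ∫ f(x) f(x+z) dx. By Plancherel, c is the cosine transform of the probability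
density |f̂|²/‖f‖₂², whose law is the spectral measure. Average c(tx) over the Gaussian law of x
with Fourier transform exp(−|ξ|²): H(t) = E_x c(tx) = E_ξ exp(−(t|ξ|)²), with ξ distributed by the
spectral measure. Splitting x into its direction u, which is uniform, and its length gives J(H) =
E_u J(c(·u)) − E log|x|. The spectral form gives J(H) = J(exp(−t²)) − E log|ξ|. Since J(e^{−t}) =
−γ, the definition of ρ says exactly that log ρ(u) = J(c(·u)) (`radialMeanLog_eq`). The theorem
follows from J(exp(−t²)) = −γ/2 = ψ(1)/2 (`upperLog_exp_neg_pow`) and E log|x| = ψ(n/2)/2 − log π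
(`gaussMeasure_log_norm`).

The Gagliardo condition makes ∫_0^1 (1 − c(tu))/t dt integrable over directions
(`lintegral_lowerLog_autocorr_lt_top`). This bounds the corresponding part of H, and hence E
log⁺|ξ|. Only the terms ∫_1^∞ and E log⁻|ξ| may be infinite. So J is kept as two separate integrals
in [0,∞], and identities are written as equalities of sums until the end (`autocorr_log_identity`).
-/

namespace RadialMean

/-! ### Regularized logarithmic integrals and their behaviour under scaling -/

/-- The logarithmic integral of `A` over `(r, ∞)`. -/
noncomputable def upperLog (A : ℝ → ℝ) (r : ℝ) : ℝ≥0∞ :=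
  ∫⁻ t in Ioi r, ENNReal.ofReal (A t / t)

/-- The logarithmic integral of `1 - A` over `(0, r]`. -/
noncomputable def lowerLog (A : ℝ → ℝ) (r : ℝ) : ℝ≥0∞ :=
  ∫⁻ t in Ioc 0 r, ENNReal.ofReal ((1 - A t) / t)

lemma lintegral_inv_Ioc {r s : ℝ} (hr : 0 < r) (hrs : r ≤ s) :
    ∫⁻ t in Ioc r s, ENNReal.ofReal (1 / t) = ENNReal.ofReal (Real.log (s / r)) := by
  have hs : 0 < s := hr.trans_le hrs
  have h_int : IntervalIntegrable (fun t : ℝ => 1 / t) volume r s := by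
    refine intervalIntegral.intervalIntegrable_one_div (fun x hx => ?_) continuousOn_id
    rw [uIcc_of_le hrs] at hx
    exact (hr.trans_le hx.1).ne'
  rw [← ofReal_integral_eq_lintegral_ofReal, ← intervalIntegral.integral_of_le hrs,
    integral_one_div_of_pos hr hs]
  · exact (intervalIntegrable_iff_integrableOn_Ioc_of_le hrs).1 h_int
  · filter_upwards [ae_restrict_mem measurableSet_Ioc] with t ht
    have : 0 < t := hr.trans ht.1
    positivity

/-- On (r, s] the integrands A/t and (1 − A)/t add up to 1/t. The additive form stays valid when
some of the terms are infinite. -/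
lemma upperLog_add_lowerLog {A : ℝ → ℝ} (hA : Measurable A)
    (hA01 : ∀ t, 0 < t → A t ∈ Icc (0 : ℝ) 1) {r s : ℝ} (hr : 0 < r) (hrs : r ≤ s) :
    upperLog A r + lowerLog A s =
      upperLog A s + lowerLog A r + ENNReal.ofReal (Real.log (s / r)) := by
  have h1 : upperLog A r = (∫⁻ t in Ioc r s, ENNReal.ofReal (A t / t)) + upperLog A s := by
    rw [upperLog, upperLog, ← Ioc_union_Ioi_eq_Ioi hrs,
      lintegral_union measurableSet_Ioi (Ioc_disjoint_Ioi le_rfl)]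
  have h2 : lowerLog A s =
      lowerLog A r + ∫⁻ t in Ioc r s, ENNReal.ofReal ((1 - A t) / t) := by
    rw [lowerLog, lowerLog, ← Ioc_union_Ioc_eq_Ioc hr.le hrs,
      lintegral_union measurableSet_Ioc (Ioc_disjoint_Ioc_of_le le_rfl)]
  have h3 : (∫⁻ t in Ioc r s, ENNReal.ofReal (A t / t)) +
      ∫⁻ t in Ioc r s, ENNReal.ofReal ((1 - A t) / t) = ENNReal.ofReal (Real.log (s / r)) := by
    rw [← lintegral_inv_Ioc hr hrs, ← lintegral_add_left (by fun_prop)]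
    refine setLIntegral_congr_fun measurableSet_Ioc fun t ht => ?_
    have ht0 : 0 < t := hr.trans ht.1
    obtain ⟨ha, hb⟩ := hA01 t ht0
    have hb' : 0 ≤ 1 - A t := by linarith
    rw [← ENNReal.ofReal_add (by positivity) (by positivity)]
    congr 1
    ring
  rw [h1, h2, ← h3]
  ring

/-- Moving the cut point from `1` to `r` changes the regularized logarithmic integral by `log r`. -/
lemma upperLog_shift {A : ℝ → ℝ} (hA : Measurable A)
    (hA01 : ∀ t, 0 < t → A t ∈ Icc (0 : ℝ) 1) {r : ℝ} (hr : 0 < r) :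
    upperLog A r + lowerLog A 1 + ENNReal.ofReal (Real.log r) =
      upperLog A 1 + lowerLog A r + ENNReal.ofReal (-Real.log r) := by
  rcases le_total 1 r with h | h
  · have := upperLog_add_lowerLog hA hA01 one_pos h
    rw [div_one] at this
    rw [this, ENNReal.ofReal_of_nonpos (p := -Real.log r) (by simpa using Real.log_nonneg h),
      add_zero]
  · have := upperLog_add_lowerLog hA hA01 hr h
    rw [one_div, Real.log_inv] at this
    rw [this, ENNReal.ofReal_of_nonpos (p := Real.log r) (Real.log_nonpos hr.le h), add_zero]

/-- The measure dt/t is invariant under dilation, so rescaling the argument only moves the domain of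
integration. -/
lemma lintegral_comp_mul_div {F : ℝ → ℝ} {r : ℝ} (hr : 0 < r) {s : Set ℝ} (hs : MeasurableSet s) :
    ∫⁻ t in s, ENNReal.ofReal (F (t * r) / t) =
      ∫⁻ t in (fun t => t * r) '' s, ENNReal.ofReal (F t / t) := by
  rw [lintegral_image_eq_lintegral_abs_deriv_mul (f' := fun _ => r) hs
    (fun x _ => by simpa using ((hasDerivAt_id x).mul_const r).hasDerivWithinAt)
    (mul_left_injective₀ hr.ne').injOn]
  refine lintegral_congr fun t => ?_
  rw [← ENNReal.ofReal_mul (abs_nonneg _), abs_of_pos hr]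
  congr 1
  rcases eq_or_ne t 0 with rfl | ht
  · simp
  · field_simp

lemma image_mul_right_Ioi_of_pos {r : ℝ} (hr : 0 < r) (a : ℝ) :
    (fun t => t * r) '' Ioi a = Ioi (a * r) :=
  (OrderIso.mulRight₀ r hr).image_Ioi a

lemma upperLog_comp_mul (A : ℝ → ℝ) {r : ℝ} (hr : 0 < r) :
    upperLog (fun t => A (t * r)) 1 = upperLog A r := by
  rw [upperLog, lintegral_comp_mul_div hr measurableSet_Ioi, image_mul_right_Ioi_of_pos hr, one_mul,
    upperLog]

lemma lowerLog_comp_mul (A : ℝ → ℝ) {r : ℝ} (hr : 0 < r) :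
    lowerLog (fun t => A (t * r)) 1 = lowerLog A r := by
  rw [lowerLog, lintegral_comp_mul_div (F := fun t => 1 - A t) hr measurableSet_Ioc,
    image_mul_right_Ioc _ _ hr, one_mul, zero_mul, lowerLog]

/-! ### Logarithmic integrals of mixtures over a probability space -/

section Average

variable {Ω : Type*} [MeasurableSpace Ω] {m : Measure Ω} [IsProbabilityMeasure m]
  {B : Ω → ℝ → ℝ} {r : Ω → ℝ} {H : ℝ → ℝ}

/-- Tonelli, followed by scale invariance for each ω, which turns the dilation by r(ω) into the cut
point r(ω). -/
lemma upperLog_average (hB : Measurable (Function.uncurry B))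
    (hB01 : ∀ ω t, 0 < t → B ω t ∈ Icc (0 : ℝ) 1) (hr : Measurable r) (hr0 : ∀ᵐ ω ∂m, 0 < r ω)
    (hH : ∀ t, 0 < t → H t = ∫ ω, B ω (t * r ω) ∂m) :
    upperLog H 1 = ∫⁻ ω, upperLog (B ω) (r ω) ∂m := by
  have hmeas : Measurable (fun p : Ω × ℝ => B p.1 (p.2 * r p.1)) :=
    hB.comp (measurable_fst.prodMk (measurable_snd.mul (hr.comp measurable_fst)))
  have h1 : ∀ t ∈ Ioi (1 : ℝ), ENNReal.ofReal (H t / t) =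
      ∫⁻ ω, ENNReal.ofReal (B ω (t * r ω) / t) ∂m := by
    intro t ht
    have ht0 : (0 : ℝ) < t := one_pos.trans ht
    have hbd : ∀ᵐ ω ∂m, B ω (t * r ω) ∈ Icc (0 : ℝ) 1 := by
      filter_upwards [hr0] with ω hω using hB01 ω _ (by positivity)
    have hm : Measurable fun ω => B ω (t * r ω) := hmeas.comp (measurable_id.prodMk measurable_const)
    rw [hH t ht0, ← integral_div, ofReal_integral_eq_lintegral_ofReal]
    · refine Integrable.div_const (Integrable.of_bound hm.aestronglyMeasurable 1 ?_) _
      filter_upwards [hbd] with ω hω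
      rw [Real.norm_of_nonneg hω.1]
      exact hω.2
    · filter_upwards [hbd] with ω hω using div_nonneg hω.1 ht0.le
  rw [upperLog, setLIntegral_congr_fun measurableSet_Ioi h1, lintegral_lintegral_swap]
  · refine lintegral_congr_ae ?_
    filter_upwards [hr0] with ω hω
    rw [← upperLog_comp_mul _ hω, upperLog]
  · exact Measurable.aemeasurable (ENNReal.measurable_ofReal.comp
      ((hmeas.comp measurable_swap).div measurable_fst))

lemma lowerLog_average (hB : Measurable (Function.uncurry B))
    (hB01 : ∀ ω t, 0 < t → B ω t ∈ Icc (0 : ℝ) 1) (hr : Measurable r) (hr0 : ∀ᵐ ω ∂m, 0 < r ω)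
    (hH : ∀ t, 0 < t → H t = ∫ ω, B ω (t * r ω) ∂m) :
    lowerLog H 1 = ∫⁻ ω, lowerLog (B ω) (r ω) ∂m := by
  have hmeas : Measurable (fun p : Ω × ℝ => B p.1 (p.2 * r p.1)) :=
    hB.comp (measurable_fst.prodMk (measurable_snd.mul (hr.comp measurable_fst)))
  have h1 : ∀ t ∈ Ioc (0 : ℝ) 1, ENNReal.ofReal ((1 - H t) / t) =
      ∫⁻ ω, ENNReal.ofReal ((1 - B ω (t * r ω)) / t) ∂m := by
    intro t ht
    have ht0 : (0 : ℝ) < t := ht.1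
    have hbd : ∀ᵐ ω ∂m, B ω (t * r ω) ∈ Icc (0 : ℝ) 1 := by
      filter_upwards [hr0] with ω hω using hB01 ω _ (by positivity)
    have hm : Measurable fun ω => B ω (t * r ω) := hmeas.comp (measurable_id.prodMk measurable_const)
    have h_int : Integrable (fun ω => B ω (t * r ω)) m := by
      refine Integrable.of_bound hm.aestronglyMeasurable 1 ?_
      filter_upwards [hbd] with ω hω
      rw [Real.norm_of_nonneg hω.1]
      exact hω.2
    have : 1 - H t = ∫ ω, (1 - B ω (t * r ω)) ∂m := by
      rw [integral_sub (integrable_const _) h_int, hH t ht0]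
      simp
    rw [this, ← integral_div, ofReal_integral_eq_lintegral_ofReal]
    · exact ((integrable_const _).sub h_int).div_const _
    · filter_upwards [hbd] with ω hω using div_nonneg (by linarith [hω.2]) ht0.le
  rw [lowerLog, setLIntegral_congr_fun measurableSet_Ioc h1, lintegral_lintegral_swap]
  · refine lintegral_congr_ae ?_
    filter_upwards [hr0] with ω hω
    rw [← lowerLog_comp_mul _ hω, lowerLog]
  · exact Measurable.aemeasurable (ENNReal.measurable_ofReal.comp
      ((measurable_const.sub (hmeas.comp measurable_swap)).div measurable_fst))

lemma measurable_upperLog (hB : Measurable (Function.uncurry B)) (hr : Measurable r) :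
    Measurable fun ω => upperLog (B ω) (r ω) := by
  have : ∀ ω, upperLog (B ω) (r ω) = ∫⁻ t, ({p : Ω × ℝ | r p.1 < p.2}.indicator
      (fun p => ENNReal.ofReal (B p.1 p.2 / p.2))) (ω, t) := by
    intro ω
    rw [upperLog, ← lintegral_indicator measurableSet_Ioi]
    rfl
  simp_rw [this]
  refine Measurable.lintegral_prod_right' (f := {p : Ω × ℝ | r p.1 < p.2}.indicator
      (fun p => ENNReal.ofReal (B p.1 p.2 / p.2))) ?_
  exact (ENNReal.measurable_ofReal.comp (hB.div measurable_snd)).indicator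
    (measurableSet_lt (hr.comp measurable_fst) measurable_snd)

lemma measurable_lowerLog (hB : Measurable (Function.uncurry B)) (hr : Measurable r) :
    Measurable fun ω => lowerLog (B ω) (r ω) := by
  have : ∀ ω, lowerLog (B ω) (r ω) = ∫⁻ t, ({p : Ω × ℝ | 0 < p.2 ∧ p.2 ≤ r p.1}.indicator
      (fun p => ENNReal.ofReal ((1 - B p.1 p.2) / p.2))) (ω, t) := by
    intro ω
    rw [lowerLog, ← lintegral_indicator measurableSet_Ioc]
    rfl
  simp_rw [this]
  refine Measurable.lintegral_prod_right' (f := {p : Ω × ℝ | 0 < p.2 ∧ p.2 ≤ r p.1}.indicator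
      (fun p => ENNReal.ofReal ((1 - B p.1 p.2) / p.2))) ?_
  exact (ENNReal.measurable_ofReal.comp ((measurable_const.sub hB).div measurable_snd)).indicator
    ((measurableSet_lt measurable_const measurable_snd).inter
      (measurableSet_le measurable_snd (hr.comp measurable_fst)))

/-- The regularized logarithmic integral of a mixture `H t = 𝔼 B (t r)`. -/
lemma upperLog_mixture (hB : Measurable (Function.uncurry B))
    (hB01 : ∀ ω t, 0 < t → B ω t ∈ Icc (0 : ℝ) 1) (hr : Measurable r) (hr0 : ∀ᵐ ω ∂m, 0 < r ω)
    (hH : ∀ t, 0 < t → H t = ∫ ω, B ω (t * r ω) ∂m) :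
    upperLog H 1 + ∫⁻ ω, lowerLog (B ω) 1 ∂m + ∫⁻ ω, ENNReal.ofReal (Real.log (r ω)) ∂m =
      ∫⁻ ω, upperLog (B ω) 1 ∂m + lowerLog H 1 + ∫⁻ ω, ENNReal.ofReal (-Real.log (r ω)) ∂m := by
  rw [upperLog_average hB hB01 hr hr0 hH, lowerLog_average hB hB01 hr hr0 hH,
    ← lintegral_add_left (measurable_upperLog hB hr),
    ← lintegral_add_right _ (by fun_prop),
    ← lintegral_add_right _ (measurable_lowerLog hB hr), ← lintegral_add_right _ (by fun_prop)]
  refine lintegral_congr_ae ?_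
  filter_upwards [hr0] with ω hω
  exact upperLog_shift (hB.comp (measurable_const.prodMk measurable_id)) (hB01 ω) hω

/-- Beyond 1 the integrand is at most 1/t, which contributes at most log r. -/
lemma lowerLog_le_add {A : ℝ → ℝ} (hA : ∀ t, 0 < t → A t ∈ Icc (0 : ℝ) 1) (r : ℝ) :
    lowerLog A r ≤ lowerLog A 1 + ENNReal.ofReal (Real.log r) := by
  rcases le_total r 1 with h | h
  · exact (lintegral_mono_set (Ioc_subset_Ioc_right h)).trans le_self_add
  · rw [lowerLog, ← Ioc_union_Ioc_eq_Ioc zero_le_one h,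
      lintegral_union measurableSet_Ioc (Ioc_disjoint_Ioc_of_le le_rfl), ← div_one r,
      ← lintegral_inv_Ioc one_pos h, div_one]
    refine add_le_add le_rfl (setLIntegral_mono' measurableSet_Ioc fun t ht => ?_)
    have ht0 : 0 < t := one_pos.trans ht.1
    have := (hA t ht0).1
    gcongr
    linarith

lemma lowerLog_mixture_lt_top (hB : Measurable (Function.uncurry B))
    (hB01 : ∀ ω t, 0 < t → B ω t ∈ Icc (0 : ℝ) 1) (hr : Measurable r) (hr0 : ∀ᵐ ω ∂m, 0 < r ω)
    (hH : ∀ t, 0 < t → H t = ∫ ω, B ω (t * r ω) ∂m)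
    (h1 : ∫⁻ ω, lowerLog (B ω) 1 ∂m < ∞) (h2 : ∫⁻ ω, ENNReal.ofReal (Real.log (r ω)) ∂m < ∞) :
    lowerLog H 1 < ∞ := by
  rw [lowerLog_average hB hB01 hr hr0 hH]
  refine lt_of_le_of_lt (lintegral_mono_ae (Filter.Eventually.of_forall fun ω => lowerLog_le_add (hB01 ω) (r ω))) ?_
  rw [lintegral_add_right _ (by fun_prop)]
  exact ENNReal.add_lt_top.2 ⟨h1, h2⟩

end Average

/-! ### Measures with a real nonnegative density -/

section WithDensity

variable {α : Type*} [MeasurableSpace α] {μ : Measure α} {w : α → ℝ}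

lemma integral_withDensity_ofReal (hw : Measurable w) (hw0 : ∀ x, 0 ≤ w x) (g : α → ℝ) :
    ∫ x, g x ∂(μ.withDensity fun x => ENNReal.ofReal (w x)) = ∫ x, w x * g x ∂μ := by
  rw [integral_withDensity_eq_integral_toReal_smul hw.ennreal_ofReal (by simp)]
  simp [ENNReal.toReal_ofReal (hw0 _)]

lemma integrable_withDensity_ofReal (hw : Measurable w) (hw0 : ∀ x, 0 ≤ w x) {g : α → ℝ} :
    Integrable g (μ.withDensity fun x => ENNReal.ofReal (w x)) ↔
      Integrable (fun x => w x * g x) μ := by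
  rw [integrable_withDensity_iff_integrable_smul' hw.ennreal_ofReal (by simp)]
  simp [ENNReal.toReal_ofReal (hw0 _)]

lemma isProbabilityMeasure_withDensity_ofReal (hw0 : ∀ x, 0 ≤ w x) (hwi : Integrable w μ)
    (h1 : ∫ x, w x ∂μ = 1) :
    IsProbabilityMeasure (μ.withDensity fun x => ENNReal.ofReal (w x)) := by
  refine ⟨?_⟩
  rw [withDensity_apply _ MeasurableSet.univ, setLIntegral_univ,
    ← ofReal_integral_eq_lintegral_ofReal hwi (.of_forall hw0), h1, ENNReal.ofReal_one]

end WithDensity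

/-! ### The logarithmic derivative of the Gamma function -/

lemma integrableOn_rpow_mul_log_mul_exp_neg {a : ℝ} (ha : 0 < a) :
    IntegrableOn (fun t : ℝ => t ^ (a - 1) * (Real.log t * Real.exp (-t))) (Ioi 0) := by
  -- Differentiability of a Mellin transform includes convergence of the integral with the extra
  -- logarithm. The orders a + 1 at infinity and 0 at the origin give a strip that contains a.
  have h := (mellin_hasDerivAt_of_isBigO_rpow (E := ℂ) (f := fun t => (Real.exp (-t) : ℂ))
    (s := (a : ℂ)) (a := a + 1) (b := 0) ?_ ?_ (by simp) ?_ (by simpa using ha)).1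
  · have h2 : IntegrableOn (fun t : ℝ => ((t ^ (a - 1) * (Real.log t * Real.exp (-t)) : ℝ) : ℂ))
        (Ioi 0) := by
      refine h.congr_fun (fun t ht => ?_) measurableSet_Ioi
      have ht0 : 0 ≤ t := le_of_lt ht
      simp [Complex.ofReal_cpow ht0]
    exact h2.re
  · refine (Continuous.continuousOn ?_).locallyIntegrableOn measurableSet_Ioi
    exact Complex.continuous_ofReal.comp (Real.continuous_exp.comp continuous_neg)
  · rw [← Asymptotics.isBigO_norm_left]
    simp_rw [Complex.norm_real, Asymptotics.isBigO_norm_left]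
    simpa only [neg_one_mul] using (isLittleO_exp_neg_mul_rpow_atTop zero_lt_one _).isBigO
  · simp_rw [neg_zero, Real.rpow_zero]
    refine Asymptotics.isBigO_const_of_tendsto (y := (1 : ℂ)) ?_ one_ne_zero
    rw [show (1 : ℂ) = (Real.exp (-0) : ℂ) by simp]
    refine (Continuous.tendsto ?_ 0).mono_left nhdsWithin_le_nhds
    exact Complex.continuous_ofReal.comp (Real.continuous_exp.comp continuous_neg)

/-- Differentiation of Euler's integral under the integral sign, done for complex argument and then
restricted to the real line. -/
lemma integral_rpow_mul_log_mul_exp_neg {a : ℝ} (ha : 0 < a) :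
    ∫ t in Ioi (0 : ℝ), t ^ (a - 1) * (Real.log t * Real.exp (-t)) = deriv Real.Gamma a := by
  have h := Complex.hasDerivAt_GammaIntegral (s := (a : ℂ)) (by simpa using ha)
  have h2 : HasDerivAt Complex.Gamma
      (∫ t : ℝ in Ioi 0, (t : ℂ) ^ ((a : ℂ) - 1) * (Real.log t * Real.exp (-t))) a := by
    refine h.congr_of_eventuallyEq ?_
    filter_upwards [(isOpen_lt continuous_const Complex.continuous_re).mem_nhds
      (show (0 : ℝ) < (a : ℂ).re by simpa using ha)] with z hz
    exact Complex.Gamma_eq_integral hz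
  have h3 : deriv Real.Gamma a = _ := h2.real_of_complex.deriv
  rw [h3, ← Complex.ofReal_re (∫ t in Ioi (0 : ℝ), t ^ (a - 1) * (Real.log t * Real.exp (-t))),
    ← integral_complex_ofReal]
  congr 1
  refine setIntegral_congr_fun measurableSet_Ioi fun t ht => ?_
  have ht0 : 0 ≤ t := le_of_lt ht
  simp [Complex.ofReal_cpow ht0]

lemma integral_rpow_mul_log_mul_exp_neg_eq_digamma {a : ℝ} (ha : 0 < a) :
    ∫ t in Ioi (0 : ℝ), t ^ (a - 1) * (Real.log t * Real.exp (-t)) =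
      digamma a * Real.Gamma a := by
  rw [integral_rpow_mul_log_mul_exp_neg ha, digamma, logDeriv_apply,
    div_mul_cancel₀ _ (Real.Gamma_pos_of_pos ha).ne']

lemma digamma_one : digamma 1 = -Real.eulerMascheroniConstant := by
  rw [digamma, logDeriv_apply, Real.Gamma_one, div_one, Real.eulerMascheroniConstant_eq_neg_deriv,
    neg_neg]

/-! ### The regularized logarithmic integral of `exp (-t ^ k)` -/

/-- For an exponential variable S, exp(−t^k) = P(S > t^k) = P(t S^{−1/k} < 1). Thus exp(−t^k) is a
mixture of dilates of the indicator of t < 1, whose regularized integral is 0. What remains is −E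
log S^{−1/k} = E(log S)/k = Γ'(1)/k. The case k = 1 absorbs the constant in the definition of ρ, and
k = 2 is the Gaussian profile. -/
lemma upperLog_exp_neg_pow {k : ℕ} (hk : k ≠ 0) :
    upperLog (fun t => Real.exp (-t ^ k)) 1 < ∞ ∧ lowerLog (fun t => Real.exp (-t ^ k)) 1 < ∞ ∧
    (upperLog (fun t => Real.exp (-t ^ k)) 1).toReal -
      (lowerLog (fun t => Real.exp (-t ^ k)) 1).toReal = -Real.eulerMascheroniConstant / k := by
  have hk0 : (0 : ℝ) < k := by exact_mod_cast Nat.pos_of_ne_zero hk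
  let w : ℝ → ℝ := fun s => Real.exp (-s)
  have hw : Measurable w := by fun_prop
  have hw0 : ∀ s, 0 ≤ w s := fun s => (Real.exp_pos _).le
  have hwi : IntegrableOn w (Ioi 0) := integrableOn_exp_neg_Ioi 0
  let m : Measure ℝ := (volume.restrict (Ioi 0)).withDensity fun s => ENNReal.ofReal (w s)
  have : IsProbabilityMeasure m :=
    isProbabilityMeasure_withDensity_ofReal hw0 hwi integral_exp_neg_Ioi_zero
  have hpos : ∀ᵐ s ∂m, 0 < s :=
    (withDensity_absolutelyContinuous _ _).ae_le (ae_restrict_mem measurableSet_Ioi)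
  let B : ℝ → ℝ → ℝ := fun _ t => (Iio (1 : ℝ)).indicator 1 t
  let r : ℝ → ℝ := fun s => s ^ (-(k : ℝ)⁻¹)
  have hB : Measurable (Function.uncurry B) :=
    (measurable_one.indicator measurableSet_Iio).comp measurable_snd
  have hB01 : ∀ s t, 0 < t → B s t ∈ Icc (0 : ℝ) 1 := by
    intro s t _
    by_cases h : t ∈ Iio (1 : ℝ) <;> simp [B, h]
  have hr : Measurable r := by fun_prop
  have hr0 : ∀ᵐ s ∂m, 0 < r s := hpos.mono fun s hs => Real.rpow_pos_of_pos hs _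
  have hH : ∀ t : ℝ, 0 < t → Real.exp (-t ^ k) = ∫ s, B s (t * r s) ∂m := by
    intro t ht
    rw [integral_withDensity_ofReal hw hw0]
    have h1 : ∀ s ∈ Ioi (0 : ℝ), w s * B s (t * r s) = (Ioi (t ^ k)).indicator w s := by
      intro s hs
      have hs0 : (0 : ℝ) < s := hs
      have : t * r s < 1 ↔ t ^ k < s := by
        have hrs : r s = (s ^ ((k : ℝ)⁻¹))⁻¹ := Real.rpow_neg hs0.le _
        have hs1 : 0 < s ^ ((k : ℝ)⁻¹) := Real.rpow_pos_of_pos hs0 _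
        rw [hrs, ← div_eq_mul_inv, div_lt_one hs1,
          ← pow_lt_pow_iff_left₀ ht.le hs1.le hk, Real.rpow_inv_natCast_pow hs0.le hk]
      by_cases h : t ^ k < s
      · simp [B, h, this.2 h]
      · simp [B, h, mt this.1 h]
    rw [setIntegral_congr_fun measurableSet_Ioi h1, setIntegral_indicator measurableSet_Ioi,
      inter_eq_self_of_subset_right (Ioi_subset_Ioi (by positivity)), integral_exp_neg_Ioi]
  have hlog : ∀ s ∈ Ioi (0 : ℝ), w s * Real.log (r s) =
      -(k : ℝ)⁻¹ * (s ^ ((1 : ℝ) - 1) * (Real.log s * Real.exp (-s))) := by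
    intro s hs
    rw [Real.log_rpow hs]
    simp [w]
    ring
  have hlogi : Integrable (fun s => Real.log (r s)) m := by
    rw [integrable_withDensity_ofReal hw hw0]
    exact IntegrableOn.congr_fun ((integrableOn_rpow_mul_log_mul_exp_neg one_pos).const_mul _)
      (fun s hs => (hlog s hs).symm) measurableSet_Ioi
  have hlogv : ∫ s, Real.log (r s) ∂m = Real.eulerMascheroniConstant / k := by
    rw [integral_withDensity_ofReal hw hw0, setIntegral_congr_fun measurableSet_Ioi hlog,
      integral_const_mul, integral_rpow_mul_log_mul_exp_neg_eq_digamma one_pos, digamma_one]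
    simp
    ring
  have hup : ∀ s, upperLog (B s) 1 = 0 := by
    intro s
    rw [upperLog, setLIntegral_congr_fun (g := 0) measurableSet_Ioi]
    · simp
    · intro t ht
      have : ¬ t < 1 := not_lt.2 (le_of_lt ht)
      simp [B, this]
  have hlo : ∀ s, lowerLog (B s) 1 = 0 := by
    intro s
    -- The indicator vanishes at t = 1 itself, so this endpoint has to be discarded first.
    rw [lowerLog, setLIntegral_congr Ioo_ae_eq_Ioc.symm,
      setLIntegral_congr_fun (g := 0) measurableSet_Ioo]
    · simp
    · intro t ht
      simp [B, ht.2]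
  have hfin1 : ∫⁻ s, ENNReal.ofReal (Real.log (r s)) ∂m < ∞ := hlogi.lintegral_lt_top
  have hfin2 : ∫⁻ s, ENNReal.ofReal (-Real.log (r s)) ∂m < ∞ := hlogi.neg.lintegral_lt_top
  have hmix := upperLog_mixture hB hB01 hr hr0 hH
  have hlow := lowerLog_mixture_lt_top hB hB01 hr hr0 hH (by simp [hlo]) hfin1
  simp only [hup, hlo, lintegral_zero, add_zero, zero_add] at hmix
  have hupp : upperLog (fun t => Real.exp (-t ^ k)) 1 < ∞ :=
    lt_of_le_of_lt (le_self_add.trans_eq hmix) (ENNReal.add_lt_top.2 ⟨hlow, hfin2⟩)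
  refine ⟨hupp, hlow, ?_⟩
  have h := congrArg ENNReal.toReal hmix
  rw [ENNReal.toReal_add hupp.ne hfin1.ne, ENNReal.toReal_add hlow.ne hfin2.ne] at h
  have h' := integral_eq_lintegral_pos_part_sub_lintegral_neg_part hlogi
  rw [hlogv] at h'
  rw [neg_div, h']
  linarith

/-! ### Polar coordinates and a Gaussian measure -/

section Polar

variable {n : ℕ}

lemma lintegral_polar (hn : 1 ≤ n) {F : EuclideanSpace ℝ (Fin n) → ℝ≥0∞} (hF : Measurable F) :
    ∫⁻ x, F x = ∫⁻ u : Metric.sphere (0 : EuclideanSpace ℝ (Fin n)) 1,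
      ∫⁻ r in Ioi (0 : ℝ), ENNReal.ofReal (r ^ (n - 1)) * F (r • (u : EuclideanSpace ℝ (Fin n)))
        ∂volume ∂(volume : Measure (EuclideanSpace ℝ (Fin n))).toSphere := by
  have : Nonempty (Fin n) := ⟨⟨0, hn⟩⟩
  have h0 : MeasurableSet ({0}ᶜ : Set (EuclideanSpace ℝ (Fin n))) :=
    (measurableSet_singleton _).compl
  have hmp := (volume : Measure (EuclideanSpace ℝ (Fin n))).measurePreserving_homeomorphUnitSphereProd
  calc ∫⁻ x, F x = ∫⁻ x in ({0}ᶜ : Set (EuclideanSpace ℝ (Fin n))), F x := by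
        rw [restrict_compl_singleton]
    _ = ∫⁻ x : ({0}ᶜ : Set (EuclideanSpace ℝ (Fin n))), F x
          ∂(volume.comap (Subtype.val : ({0}ᶜ : Set (EuclideanSpace ℝ (Fin n))) → _)) :=
        (MeasureTheory.lintegral_subtype_comap h0 F).symm
    _ = ∫⁻ p, F ((p.2 : ℝ) • (p.1 : EuclideanSpace ℝ (Fin n)))
          ∂((volume : Measure (EuclideanSpace ℝ (Fin n))).toSphere.prod (.volumeIoiPow (n - 1))) := by
        rw [finrank_euclideanSpace_fin] at hmp
        rw [← hmp.lintegral_comp_emb (Homeomorph.measurableEmbedding _)]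
        refine lintegral_congr fun x => ?_
        have hx : ‖(x : EuclideanSpace ℝ (Fin n))‖ ≠ 0 := norm_ne_zero_iff.2 x.2
        simp [smul_smul, hx]
    _ = _ := by
        rw [lintegral_prod _ (by fun_prop)]
        refine lintegral_congr fun u => ?_
        rw [Measure.volumeIoiPow, lintegral_withDensity_eq_lintegral_mul _ (by fun_prop)
          (by fun_prop)]
        exact MeasureTheory.lintegral_subtype_comap measurableSet_Ioi
          (fun r : ℝ => ENNReal.ofReal (r ^ (n - 1)) * F (r • (u : EuclideanSpace ℝ (Fin n))))

end Polar

section Gauss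

/-- The Gaussian probability density whose Fourier transform is `exp (-‖ξ‖ ^ 2)`. -/
noncomputable def gaussDensity {n : ℕ} (x : EuclideanSpace ℝ (Fin n)) : ℝ :=
  Real.pi ^ ((n : ℝ) / 2) * Real.exp (-Real.pi ^ 2 * ‖x‖ ^ 2)

/-- The Gaussian probability measure whose characteristic function is `exp (-‖ξ‖ ^ 2)`. -/
noncomputable def gaussMeasure (n : ℕ) : Measure (EuclideanSpace ℝ (Fin n)) :=
  volume.withDensity fun x => ENNReal.ofReal (gaussDensity x)

variable {n : ℕ}

lemma gaussDensity_nonneg (x : EuclideanSpace ℝ (Fin n)) : 0 ≤ gaussDensity x := by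
  unfold gaussDensity
  positivity

lemma measurable_gaussDensity : Measurable (gaussDensity (n := n)) := by
  unfold gaussDensity
  fun_prop

lemma integrable_gaussDensity : Integrable (gaussDensity (n := n)) := by
  have h := GaussianFourier.integrable_cexp_neg_mul_sq_norm_add (V := EuclideanSpace ℝ (Fin n))
    (b := ((Real.pi ^ 2 : ℝ) : ℂ)) (by rw [Complex.ofReal_re]; positivity) 0 0
  refine Integrable.const_mul ?_ _
  convert h.re using 2 with x
  have : -((Real.pi ^ 2 : ℝ) : ℂ) * (‖x‖ : ℂ) ^ 2 +
      0 * ((inner ℝ (0 : EuclideanSpace ℝ (Fin n)) x : ℝ) : ℂ) =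
      ((-Real.pi ^ 2 * ‖x‖ ^ 2 : ℝ) : ℂ) := by push_cast; ring
  rw [this, ← Complex.ofReal_exp, RCLike.re_eq_complex_re, Complex.ofReal_re]

/-- Real part of the Gaussian Fourier integral. With variance parameter π² and frequency 2πy the
exponent is −(2π)²‖y‖²/(4π²) = −‖y‖². -/
lemma integral_gaussDensity_mul_cos (y : EuclideanSpace ℝ (Fin n)) :
    ∫ x, gaussDensity x * Real.cos (2 * Real.pi * inner ℝ y x) = Real.exp (-‖y‖ ^ 2) := by
  have hb : 0 < (((Real.pi ^ 2 : ℝ) : ℂ)).re := by rw [Complex.ofReal_re]; positivity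
  have hi := GaussianFourier.integrable_cexp_neg_mul_sq_norm_add (V := EuclideanSpace ℝ (Fin n)) hb
    (2 * Real.pi * Complex.I) y
  have h := GaussianFourier.integral_cexp_neg_mul_sq_norm_add hb (2 * Real.pi * Complex.I) y
  have h1 : ∀ x : EuclideanSpace ℝ (Fin n), gaussDensity x * Real.cos (2 * Real.pi * inner ℝ y x) =
      Real.pi ^ ((n : ℝ) / 2) * RCLike.re (Complex.exp (-((Real.pi ^ 2 : ℝ) : ℂ) * (‖x‖ : ℂ) ^ 2 +
        2 * Real.pi * Complex.I * ((inner ℝ y x : ℝ) : ℂ))) := by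
    intro x
    have : -((Real.pi ^ 2 : ℝ) : ℂ) * (‖x‖ : ℂ) ^ 2 +
        2 * Real.pi * Complex.I * ((inner ℝ y x : ℝ) : ℂ) =
        ((-Real.pi ^ 2 * ‖x‖ ^ 2 : ℝ) : ℂ) + ((2 * Real.pi * inner ℝ y x : ℝ) : ℂ) * Complex.I := by
      push_cast; ring
    rw [this, Complex.exp_add, ← Complex.ofReal_exp, RCLike.re_eq_complex_re,
      Complex.re_ofReal_mul, Complex.exp_ofReal_mul_I_re, gaussDensity]
    ring
  simp_rw [h1]
  rw [integral_const_mul, integral_re hi, h]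
  have h2 : (((Real.pi : ℂ) / ((Real.pi ^ 2 : ℝ) : ℂ)) ^
      ((Module.finrank ℝ (EuclideanSpace ℝ (Fin n)) : ℂ) / 2)) *
      Complex.exp ((2 * Real.pi * Complex.I) ^ 2 * (‖y‖ : ℂ) ^ 2 / (4 * ((Real.pi ^ 2 : ℝ) : ℂ))) =
      (((Real.pi⁻¹) ^ ((n : ℝ) / 2) * Real.exp (-‖y‖ ^ 2) : ℝ) : ℂ) := by
    have hpi : (Real.pi : ℂ) ≠ 0 := by exact_mod_cast Real.pi_ne_zero
    rw [finrank_euclideanSpace_fin, Complex.ofReal_mul, Complex.ofReal_cpow (by positivity)]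
    congr 1
    · push_cast
      congr 1
      field_simp
    · rw [Complex.ofReal_exp]
      congr 1
      push_cast
      field_simp
      rw [Complex.I_sq]
      ring
  rw [h2, RCLike.re_eq_complex_re, Complex.ofReal_re, Real.inv_rpow Real.pi_pos.le, ← mul_assoc,
    mul_inv_cancel₀ (Real.rpow_pos_of_pos Real.pi_pos _).ne', one_mul]

lemma integral_gaussDensity : ∫ x, gaussDensity (n := n) x = 1 := by
  simpa using integral_gaussDensity_mul_cos (0 : EuclideanSpace ℝ (Fin n))

instance : IsProbabilityMeasure (gaussMeasure n) :=
  isProbabilityMeasure_withDensity_ofReal gaussDensity_nonneg integrable_gaussDensity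
    integral_gaussDensity

lemma gaussMeasure_ae_norm_pos (hn : 1 ≤ n) : ∀ᵐ x ∂(gaussMeasure n), 0 < ‖x‖ := by
  have : Nonempty (Fin n) := ⟨⟨0, hn⟩⟩
  have h : ∀ᵐ x : EuclideanSpace ℝ (Fin n), 0 < ‖x‖ := by
    filter_upwards [compl_mem_ae_iff.2 (measure_singleton (0 : EuclideanSpace ℝ (Fin n)))] with x hx
    exact norm_pos_iff.2 hx
  exact (withDensity_absolutelyContinuous _ _).ae_le h

/-- The angular part of `gaussMeasure n` is the normalized spherical measure. -/
lemma lintegral_gaussMeasure_angular (hn : 1 ≤ n) {F : EuclideanSpace ℝ (Fin n) → ℝ≥0∞}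
    (hF : Measurable F) :
    ENNReal.ofReal (n * unitBallVolume n) * ∫⁻ x, F (‖x‖⁻¹ • x) ∂(gaussMeasure n) =
      ∫⁻ u : Metric.sphere (0 : EuclideanSpace ℝ (Fin n)) 1, F u
        ∂(volume : Measure (EuclideanSpace ℝ (Fin n))).toSphere := by
  have : Nonempty (Fin n) := ⟨⟨0, hn⟩⟩
  -- The radial factor in polar coordinates does not depend on F. It is never evaluated: testing
  -- with F = 1 shows that it is the inverse of the sphere's total mass.
  let K : ℝ≥0∞ := ∫⁻ r in Ioi (0 : ℝ), ENNReal.ofReal (r ^ (n - 1)) *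
    ENNReal.ofReal (Real.pi ^ ((n : ℝ) / 2) * Real.exp (-Real.pi ^ 2 * r ^ 2))
  have key : ∀ F : EuclideanSpace ℝ (Fin n) → ℝ≥0∞, Measurable F →
      ∫⁻ x, F (‖x‖⁻¹ • x) ∂(gaussMeasure n) =
        K * ∫⁻ u : Metric.sphere (0 : EuclideanSpace ℝ (Fin n)) 1, F u
          ∂(volume : Measure (EuclideanSpace ℝ (Fin n))).toSphere := by
    intro F hF
    rw [gaussMeasure, lintegral_withDensity_eq_lintegral_mul _
      measurable_gaussDensity.ennreal_ofReal (by fun_prop), lintegral_polar hn]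
    · rw [← lintegral_const_mul _ (by fun_prop)]
      refine lintegral_congr fun u => ?_
      rw [← lintegral_mul_const _ (by fun_prop)]
      refine setLIntegral_congr_fun measurableSet_Ioi fun r hr => ?_
      have hr0 : (0 : ℝ) < r := hr
      have hu : ‖(u : EuclideanSpace ℝ (Fin n))‖ = 1 := by simp
      have hnorm : ‖r • (u : EuclideanSpace ℝ (Fin n))‖ = r := by
        rw [norm_smul, hu, mul_one, Real.norm_of_nonneg hr0.le]
      simp only [Pi.mul_apply, gaussDensity]
      rw [hnorm, smul_smul, inv_mul_cancel₀ hr0.ne', one_smul, mul_assoc]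
    · exact measurable_gaussDensity.ennreal_ofReal.mul (by fun_prop)
  have h1 := key 1 measurable_one
  simp only [Pi.one_apply, lintegral_const, measure_univ, one_mul,
    Measure.toSphere_apply_univ, finrank_euclideanSpace_fin] at h1
  rw [key F hF, ← mul_assoc, unitBallVolume, ENNReal.ofReal_mul (by positivity),
    ENNReal.ofReal_natCast, measureReal_def, ENNReal.ofReal_toReal measure_ball_lt_top.ne,
    mul_comm _ K, ← h1, one_mul]

/-- Polar coordinates and the substitution s = π²r² turn the Gaussian weight into the integrand of
Γ(n/2). -/
lemma gaussMeasure_radial (hn : 1 ≤ n) (F : ℝ → ℝ) :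
    (Integrable (fun x : EuclideanSpace ℝ (Fin n) => F ‖x‖) (gaussMeasure n) ↔
      IntegrableOn (fun s : ℝ => Real.exp (-s) * s ^ ((n : ℝ) / 2 - 1) * F (√s / Real.pi)) (Ioi 0)) ∧
    ∫ x, F ‖x‖ ∂(gaussMeasure n) = (n * unitBallVolume n / (2 * Real.pi ^ ((n : ℝ) / 2))) *
      ∫ s in Ioi (0 : ℝ), Real.exp (-s) * s ^ ((n : ℝ) / 2 - 1) * F (√s / Real.pi) := by
  have : Nonempty (Fin n) := ⟨⟨0, hn⟩⟩
  have hpi := Real.pi_pos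
  set G : ℝ → ℝ := fun s => Real.exp (-s) * s ^ ((n : ℝ) / 2 - 1) * F (√s / Real.pi) with hG
  set w : ℝ → ℝ := fun r => Real.pi ^ ((n : ℝ) / 2) * Real.exp (-Real.pi ^ 2 * r ^ 2) with hw
  have hpt : ∀ r ∈ Ioi (0 : ℝ), r ^ (n - 1) • (w r * F r) =
      (2 * Real.pi ^ ((n : ℝ) / 2))⁻¹ * Real.pi ^ 2 *
        ((2 * r ^ ((2 : ℝ) - 1)) • G (Real.pi ^ 2 * r ^ (2 : ℝ))) := by
    intro r hr
    have hr0 : (0 : ℝ) < r := hr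
    have e1 : Real.pi ^ 2 * r ^ (2 : ℝ) = (Real.pi * r) ^ 2 := by
      rw [Real.rpow_two]; ring
    have e2 : ((Real.pi * r) ^ 2) ^ ((n : ℝ) / 2 - 1) = (Real.pi * r) ^ n / (Real.pi * r) ^ 2 := by
      rw [← Real.rpow_natCast (Real.pi * r) 2, ← Real.rpow_mul (by positivity),
        ← Real.rpow_natCast (Real.pi * r) n, ← Real.rpow_sub (by positivity)]
      congr 1
      push_cast
      ring
    have e3 : Real.pi ^ n = Real.pi ^ ((n : ℝ) / 2) * Real.pi ^ ((n : ℝ) / 2) := by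
      rw [← Real.rpow_add hpi, ← Real.rpow_natCast]
      congr 1
      ring
    have e4 : r ^ n = r ^ (n - 1) * r := by rw [← pow_succ, Nat.sub_add_cancel hn]
    have e5 : √((Real.pi * r) ^ 2) / Real.pi = r := by
      rw [Real.sqrt_sq (by positivity)]
      field_simp
    have e6 : r ^ ((2 : ℝ) - 1) = r := by norm_num
    have hne : Real.pi ^ ((n : ℝ) / 2) ≠ 0 := (Real.rpow_pos_of_pos hpi _).ne'
    simp only [hG, hw, smul_eq_mul]
    rw [e1, e2, e5, e6, mul_pow Real.pi r n, e3, e4,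
      show -(Real.pi * r) ^ 2 = -Real.pi ^ 2 * r ^ 2 by ring]
    field_simp
  have hc : (2 * Real.pi ^ ((n : ℝ) / 2))⁻¹ * Real.pi ^ 2 ≠ 0 := by positivity
  have hdens : ∀ x : EuclideanSpace ℝ (Fin n), gaussDensity x * F ‖x‖ = w ‖x‖ * F ‖x‖ :=
    fun x => rfl
  constructor
  · rw [gaussMeasure, integrable_withDensity_ofReal measurable_gaussDensity gaussDensity_nonneg]
    simp_rw [hdens]
    rw [integrable_fun_norm_addHaar volume (f := fun r => w r * F r), finrank_euclideanSpace_fin,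
      integrableOn_congr_fun hpt measurableSet_Ioi, IntegrableOn,
      integrable_const_mul_iff (IsUnit.mk0 _ hc), ← IntegrableOn]
    have := integrableOn_Ioi_comp_rpow_iff (fun y => G (Real.pi ^ 2 * y)) (p := 2) two_ne_zero
    rw [abs_two] at this
    rw [this, integrableOn_Ioi_comp_mul_left_iff G 0 (by positivity), mul_zero]
  · rw [gaussMeasure, integral_withDensity_ofReal measurable_gaussDensity gaussDensity_nonneg]
    simp_rw [hdens]
    rw [integral_fun_norm_addHaar volume (fun r => w r * F r), finrank_euclideanSpace_fin,
      setIntegral_congr_fun measurableSet_Ioi hpt, integral_const_mul,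
      integral_comp_rpow_Ioi_of_pos (g := fun y => G (Real.pi ^ 2 * y)) two_pos,
      integral_comp_mul_left_Ioi G 0 (by positivity), mul_zero, ← unitBallVolume]
    simp only [nsmul_eq_mul, smul_eq_mul]
    field_simp

lemma gaussMeasure_log_norm (hn : 1 ≤ n) :
    Integrable (fun x : EuclideanSpace ℝ (Fin n) => Real.log ‖x‖) (gaussMeasure n) ∧
    ∫ x, Real.log ‖x‖ ∂(gaussMeasure n) = digamma (n / 2) / 2 - Real.log Real.pi := by
  have ha : (0 : ℝ) < (n : ℝ) / 2 := by
    have : (0 : ℝ) < n := by exact_mod_cast hn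
    positivity
  -- Total mass 1 shows that the prefactor is 1/Γ(n/2), so no explicit formula for the volume of the
  -- ball is needed.
  have hone := (gaussMeasure_radial hn (fun _ => 1)).2
  simp only [integral_const, mul_one, probReal_univ, smul_eq_mul] at hone
  rw [← Real.Gamma_eq_integral ha] at hone
  have hpt : ∀ s ∈ Ioi (0 : ℝ),
      Real.exp (-s) * s ^ ((n : ℝ) / 2 - 1) * Real.log (√s / Real.pi) =
      (1 / 2) * (s ^ ((n : ℝ) / 2 - 1) * (Real.log s * Real.exp (-s))) -
        Real.log Real.pi * (Real.exp (-s) * s ^ ((n : ℝ) / 2 - 1)) := by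
    intro s hs
    have hs0 : (0 : ℝ) < s := hs
    rw [Real.log_div (Real.sqrt_pos.2 hs0).ne' Real.pi_ne_zero, Real.log_sqrt hs0.le]
    ring
  have hi1 := (integrableOn_rpow_mul_log_mul_exp_neg ha).const_mul (1 / 2)
  have hi2 := (Real.GammaIntegral_convergent ha).const_mul (Real.log Real.pi)
  constructor
  · rw [(gaussMeasure_radial hn Real.log).1, integrableOn_congr_fun hpt measurableSet_Ioi]
    exact hi1.sub hi2
  · rw [(gaussMeasure_radial hn Real.log).2, setIntegral_congr_fun measurableSet_Ioi hpt,
      integral_sub hi1 hi2, integral_const_mul, integral_const_mul,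
      integral_rpow_mul_log_mul_exp_neg_eq_digamma ha, ← Real.Gamma_eq_integral ha]
    linear_combination (-(digamma (n / 2) / 2 - Real.log Real.pi)) * hone

end Gauss

/-! ### Translations and the Fourier transform on L² -/

section Translation

variable {V : Type*} [NormedAddCommGroup V] [InnerProductSpace ℝ V]

/-- The character `ξ ↦ exp (2 π i ⟨z, ξ⟩)`. -/
noncomputable def character (z ξ : V) : ℂ := Complex.exp ((2 * Real.pi * inner ℝ z ξ : ℝ) * Complex.I)

lemma norm_character (z ξ : V) : ‖character z ξ‖ = 1 := Complex.norm_exp_ofReal_mul_I _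

lemma continuous_character (z : V) : Continuous (character z) := by
  unfold character
  fun_prop

variable [FiniteDimensional ℝ V] [MeasurableSpace V] [BorelSpace V]

lemma memLp_top_character (z : V) : MemLp (character z) ∞ (volume : Measure V) :=
  memLp_top_of_bound (continuous_character z).aestronglyMeasurable 1
    (.of_forall fun ξ => (norm_character z ξ).le)

lemma measurePreserving_add_right_volume (z : V) :
    MeasurePreserving (fun x : V => x + z) volume volume :=
  measurePreserving_add_right volume z

/-- The Fourier transform on `L²` turns translations into multiplication by characters. -/
lemma fourier_translate (z : V) (g : Lp (α := V) ℂ 2) :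
    𝓕 (Lp.compMeasurePreserving _ (measurePreserving_add_right_volume z) g) =
      (ContinuousLinearMap.mul ℂ ℂ).holderL volume ∞ 2 2 ((memLp_top_character z).toLp _) (𝓕 g) := by
  -- Both sides are continuous in g, so it suffices to check Schwartz functions, where the transform
  -- is an integral.
  refine DenseRange.induction_on (p := fun g : Lp (α := V) ℂ 2 =>
    𝓕 (Lp.compMeasurePreserving _ (measurePreserving_add_right_volume z) g) =
      (ContinuousLinearMap.mul ℂ ℂ).holderL volume ∞ 2 2 ((memLp_top_character z).toLp _) (𝓕 g))
    (SchwartzMap.denseRange_toLpCLM (p := 2) ENNReal.ofNat_ne_top) g ?_ ?_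
  · refine isClosed_eq ?_ ?_
    · exact (Lp.fourierTransformₗᵢ V ℂ).continuous.comp
        (Lp.isometry_compMeasurePreserving (measurePreserving_add_right_volume z)).continuous
    · exact (ContinuousLinearMap.continuous _).comp (Lp.fourierTransformₗᵢ V ℂ).continuous
  · intro φ
    have h1 : Lp.compMeasurePreserving _ (measurePreserving_add_right_volume z) (φ.toLp 2) =
        (SchwartzMap.compSubConstCLM ℝ (-z) φ).toLp 2 := by
      refine Lp.ext ?_
      filter_upwards [Lp.coeFn_compMeasurePreserving (φ.toLp 2)
          (measurePreserving_add_right_volume z),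
        (measurePreserving_add_right_volume z).quasiMeasurePreserving.ae
          (φ.coeFn_toLp 2 volume), (SchwartzMap.compSubConstCLM ℝ (-z) φ).coeFn_toLp 2 volume]
        with x h1 h2 h3
      rw [h1, h3, Function.comp_apply, h2]
      simp
    rw [SchwartzMap.toLpCLM_apply, h1, SchwartzMap.toLp_fourier_eq, SchwartzMap.toLp_fourier_eq]
    refine Lp.ext ?_
    filter_upwards [(𝓕 (SchwartzMap.compSubConstCLM ℝ (-z) φ)).coeFn_toLp 2 volume,
      (ContinuousLinearMap.mul ℂ ℂ).coeFn_holder (r := 2) ((memLp_top_character z).toLp _)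
        ((𝓕 φ).toLp 2), (memLp_top_character z).coeFn_toLp, (𝓕 φ).coeFn_toLp 2 volume]
      with ξ h1 h2 h3 h4
    rw [h1, ContinuousLinearMap.holderL_apply_apply, h2, h3, h4, SchwartzMap.fourier_coe,
      SchwartzMap.fourier_coe, ContinuousLinearMap.mul_apply']
    have h5 : (SchwartzMap.compSubConstCLM ℝ (-z) φ : V → ℂ) = φ ∘ fun v => v + z := by
      ext v
      simp
    rw [h5]
    have h6 := congrFun (VectorFourier.fourierIntegral_comp_add_right Real.fourierChar volume
      (innerₗ V) (φ : V → ℂ) z) ξ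
    refine h6.trans ?_
    rw [Circle.smul_def, smul_eq_mul]
    congr 1

/-- Plancherel, with the translation turned into a character on the Fourier side. -/
lemma inner_translate (z : V) (g : Lp (α := V) ℂ 2) :
    inner ℂ g (Lp.compMeasurePreserving _ (measurePreserving_add_right_volume z) g) =
      ∫ ξ, ((‖(𝓕 g : Lp (α := V) ℂ 2) ξ‖ ^ 2 : ℝ) : ℂ) * character z ξ := by
  rw [← Lp.inner_fourier_eq, fourier_translate, L2.inner_def]
  refine integral_congr_ae ?_
  filter_upwards [(ContinuousLinearMap.mul ℂ ℂ).coeFn_holder (r := 2)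
    ((memLp_top_character z).toLp _) (𝓕 g), (memLp_top_character z).coeFn_toLp] with ξ h1 h2
  rw [ContinuousLinearMap.holderL_apply_apply, h1, h2, ContinuousLinearMap.mul_apply',
    RCLike.inner_apply, Complex.ofReal_pow, ← Complex.mul_conj']
  ring

end Translation

/-! ### The normalized autocorrelation and its spectral density -/

section Autocorrelation

variable {n : ℕ} {f : EuclideanSpace ℝ (Fin n) → ℝ}

lemma integrable_fourierL2_sq (hf : MemLp f 2 volume) :
    Integrable (fun ξ => ‖fourierL2 f hf ξ‖ ^ 2) :=
  (Lp.memLp (fourierL2 f hf)).integrable_norm_pow two_ne_zero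

/-- The autocorrelation of `f` is the Fourier transform of `|f̂|²`. -/
lemma autocorrelation_eq (hf : MemLp f 2 volume) (z : EuclideanSpace ℝ (Fin n)) :
    ∫ x, f x * f (x + z) =
      ∫ ξ, ‖fourierL2 f hf ξ‖ ^ 2 * Real.cos (2 * Real.pi * inner ℝ z ξ) := by
  have hC : MemLp (fun x => (f x : ℂ)) 2 volume := hf.ofReal
  have h := inner_translate z (hC.toLp _)
  have hL : inner ℂ (hC.toLp _) (Lp.compMeasurePreserving _
      (measurePreserving_add_right_volume z) (hC.toLp _)) = ((∫ x, f x * f (x + z) : ℝ) : ℂ) := by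
    rw [L2.inner_def, ← integral_complex_ofReal]
    refine integral_congr_ae ?_
    filter_upwards [hC.coeFn_toLp, Lp.coeFn_compMeasurePreserving (hC.toLp _)
        (measurePreserving_add_right_volume z),
      (measurePreserving_add_right_volume z).quasiMeasurePreserving.ae hC.coeFn_toLp]
      with x h1 h2 h3
    rw [h1, h2, Function.comp_apply, h3, RCLike.inner_apply, Complex.conj_ofReal]
    push_cast
    ring
  have h_int : Integrable fun ξ => ((‖fourierL2 f hf ξ‖ ^ 2 : ℝ) : ℂ) * character z ξ := by
    refine (integrable_fourierL2_sq hf).ofReal.mul_bdd (c := 1)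
      (continuous_character z).aestronglyMeasurable (.of_forall fun ξ => (norm_character z ξ).le)
  rw [hL] at h
  -- The left side is real because f is, so only the cosine part of the character survives.
  have h2 := congrArg Complex.re h
  rw [Complex.ofReal_re] at h2
  rw [h2]
  have h3 := integral_re h_int
  rw [RCLike.re_eq_complex_re] at h3
  refine h3.symm.trans (integral_congr_ae (.of_forall fun ξ => ?_))
  simp only
  rw [Complex.re_ofReal_mul, character, Complex.exp_ofReal_mul_I_re]

lemma l2NormSq_eq (hf : MemLp f 2 volume) : l2NormSq f = ∫ ξ, ‖fourierL2 f hf ξ‖ ^ 2 := by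
  have h := autocorrelation_eq hf 0
  simpa [l2NormSq, sq] using h

lemma l2NormSq_pos (hf : MemLp f 2 volume) (hf_ne : ¬ f =ᵐ[volume] 0) : 0 < l2NormSq f := by
  have h0 : 0 ≤ l2NormSq f := integral_nonneg fun x => sq_nonneg _
  refine lt_of_le_of_ne h0 fun h => hf_ne ?_
  have := (integral_eq_zero_iff_of_nonneg (fun x => sq_nonneg (f x)) hf.integrable_sq).1 h.symm
  filter_upwards [this] with x hx
  exact pow_eq_zero_iff two_ne_zero |>.1 hx

/-- The normalized autocorrelation function. -/
noncomputable def autocorr (f : EuclideanSpace ℝ (Fin n) → ℝ) (z : EuclideanSpace ℝ (Fin n)) : ℝ :=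
  1 / l2NormSq f * ∫ x, f x * f (x + z)

/-- The spectral probability density `|f̂|² / ‖f‖₂²`. -/
noncomputable def spectralDensity (f : EuclideanSpace ℝ (Fin n) → ℝ) (hf : MemLp f 2 volume)
    (ξ : EuclideanSpace ℝ (Fin n)) : ℝ :=
  1 / l2NormSq f * ‖fourierL2 f hf ξ‖ ^ 2

lemma measurable_spectralDensity (hf : MemLp f 2 volume) : Measurable (spectralDensity f hf) :=
  ((Lp.stronglyMeasurable (fourierL2 f hf)).measurable.norm.pow_const 2).const_mul _

lemma spectralDensity_nonneg (hf : MemLp f 2 volume) (ξ) : 0 ≤ spectralDensity f hf ξ := by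
  have h0 : 0 ≤ l2NormSq f := integral_nonneg fun x => sq_nonneg _
  unfold spectralDensity
  positivity

lemma integrable_spectralDensity (hf : MemLp f 2 volume) : Integrable (spectralDensity f hf) :=
  (integrable_fourierL2_sq hf).const_mul _

lemma integral_spectralDensity (hf : MemLp f 2 volume) (hf_ne : ¬ f =ᵐ[volume] 0) :
    ∫ ξ, spectralDensity f hf ξ = 1 := by
  simp only [spectralDensity]
  rw [integral_const_mul, ← l2NormSq_eq hf, one_div_mul_cancel (l2NormSq_pos hf hf_ne).ne']

lemma autocorr_eq (hf : MemLp f 2 volume) (z : EuclideanSpace ℝ (Fin n)) :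
    autocorr f z = ∫ ξ, spectralDensity f hf ξ * Real.cos (2 * Real.pi * inner ℝ z ξ) := by
  rw [autocorr, autocorrelation_eq hf, ← integral_const_mul]
  simp only [spectralDensity, mul_assoc]

lemma continuous_autocorr (hf : MemLp f 2 volume) : Continuous (autocorr f) := by
  simp_rw [funext (autocorr_eq hf)]
  refine continuous_of_dominated (bound := spectralDensity f hf) (fun z => ?_) (fun z => ?_)
    (integrable_spectralDensity hf) ?_
  · exact ((measurable_spectralDensity hf).mul (by fun_prop)).aestronglyMeasurable
  · refine .of_forall fun ξ => ?_
    rw [norm_mul, Real.norm_of_nonneg (spectralDensity_nonneg hf ξ)]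
    exact mul_le_of_le_one_right (spectralDensity_nonneg hf ξ) (Real.abs_cos_le_one _)
  · exact .of_forall fun ξ => by fun_prop

/-- This is where the sign of f enters: it gives the lower half of the range [0,1] required by the
logarithmic integrals. The upper half comes from the spectral representation. -/
lemma autocorr_nonneg (hf0 : 0 ≤ᵐ[volume] f) (z : EuclideanSpace ℝ (Fin n)) : 0 ≤ autocorr f z := by
  have h0 : 0 ≤ l2NormSq f := integral_nonneg fun x => sq_nonneg _
  refine mul_nonneg (by positivity) (integral_nonneg_of_ae ?_)
  filter_upwards [hf0, (measurePreserving_add_right_volume z).quasiMeasurePreserving.ae hf0]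
    with x h1 h2
  exact mul_nonneg h1 h2

lemma autocorr_le_one (hf : MemLp f 2 volume) (hf_ne : ¬ f =ᵐ[volume] 0)
    (z : EuclideanSpace ℝ (Fin n)) : autocorr f z ≤ 1 := by
  rw [autocorr_eq hf, ← integral_spectralDensity hf hf_ne]
  refine integral_mono ?_ (integrable_spectralDensity hf) fun ξ =>
    mul_le_of_le_one_right (spectralDensity_nonneg hf ξ) (Real.cos_le_one _)
  exact (integrable_spectralDensity hf).mul_bdd (c := 1) (by fun_prop)
    (.of_forall fun ξ => Real.abs_cos_le_one _)

/-- Averaging the autocorrelation against a Gaussian. -/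
lemma integral_autocorr_gaussMeasure (hf : MemLp f 2 volume) (t : ℝ) :
    ∫ x, autocorr f (t • x) ∂(gaussMeasure n) =
      ∫ ξ, spectralDensity f hf ξ * Real.exp (-(t * ‖ξ‖) ^ 2) := by
  rw [gaussMeasure, integral_withDensity_ofReal measurable_gaussDensity gaussDensity_nonneg]
  simp_rw [autocorr_eq hf, ← integral_const_mul]
  rw [integral_integral_swap]
  · refine integral_congr_ae (.of_forall fun ξ => ?_)
    -- Moving t from x to ξ in the inner product exposes the Gaussian's transform at tξ.
    have : ∀ x : EuclideanSpace ℝ (Fin n), gaussDensity x *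
        (spectralDensity f hf ξ * Real.cos (2 * Real.pi * inner ℝ (t • x) ξ)) =
        spectralDensity f hf ξ * (gaussDensity x * Real.cos (2 * Real.pi * inner ℝ (t • ξ) x)) := by
      intro x
      rw [inner_smul_left, inner_smul_left, real_inner_comm]
      ring
    simp_rw [this]
    rw [integral_const_mul, integral_gaussDensity_mul_cos, norm_smul, mul_pow, mul_pow,
      Real.norm_eq_abs, sq_abs]
  · have h := (integrable_gaussDensity (n := n)).mul_prod (integrable_spectralDensity hf)
    refine h.mono' ?_ (.of_forall fun p => ?_)
    · refine Measurable.aestronglyMeasurable ?_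
      refine (measurable_gaussDensity.comp measurable_fst).mul
        (((measurable_spectralDensity hf).comp measurable_snd).mul ?_)
      fun_prop
    · simp only [Function.uncurry]
      rw [norm_mul, norm_mul, Real.norm_of_nonneg (spectralDensity_nonneg hf _),
        Real.norm_of_nonneg (gaussDensity_nonneg _)]
      gcongr
      · exact gaussDensity_nonneg _
      · exact mul_le_of_le_one_right (spectralDensity_nonneg hf _) (Real.abs_cos_le_one _)

end Autocorrelation

/-! ### Extended integrals as differences of nonnegative integrals -/

section ExtIntegral

lemma coe_ennreal_sub_eq_coe_ennreal_sub {a b c d : ℝ≥0∞} (h : a + d = c + b) (hb : b ≠ ∞)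
    (hd : d ≠ ∞) : (a : EReal) - b = (c : EReal) - d := by
  lift b to ℝ≥0 using hb
  lift d to ℝ≥0 using hd
  by_cases ha : a = ∞
  · have hc : c = ∞ := by
      by_contra hc
      lift c to ℝ≥0 using hc
      simp [ha] at h
      exact ENNReal.coe_ne_top h.symm
    subst ha hc
    rfl
  · have hc : c ≠ ∞ := by
      rintro rfl
      rw [top_add] at h
      exact (ENNReal.add_ne_top.2 ⟨ha, ENNReal.coe_ne_top⟩) h
    lift a to ℝ≥0 using ha
    lift c to ℝ≥0 using hc
    have h' : (a : ℝ) + d = c + b := by exact_mod_cast h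
    have : ((a : ℝ) - b) = (c : ℝ) - d := by linarith
    change ((a : ℝ) : EReal) - ((b : ℝ) : EReal) = ((c : ℝ) : EReal) - ((d : ℝ) : EReal)
    rw [← EReal.coe_sub, ← EReal.coe_sub, this]

variable {α : Type*} [MeasurableSpace α] {μ : Measure α} {P N : α → ℝ≥0∞} {h : α → EReal}

/-- The extended integral of a difference whose subtrahend has finite integral. -/
lemma extIntegral_sub (hP : AEMeasurable P μ) (hN : AEMeasurable N μ) (hfin : ∫⁻ x, N x ∂μ ≠ ∞)
    (hh : ∀ᵐ x ∂μ, h x = (P x : EReal) - N x) :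
    IntegralExists μ h ∧
      extIntegral μ h = ((∫⁻ x, P x ∂μ : ℝ≥0∞) : EReal) - ((∫⁻ x, N x ∂μ : ℝ≥0∞) : EReal) := by
  have hNtop : ∀ᵐ x ∂μ, N x ≠ ∞ := (ae_lt_top' hN hfin).mono fun x hx => hx.ne
  have h1 : ∫⁻ x, (h x).toENNReal ∂μ = ∫⁻ x, (P x - N x) ∂μ := by
    refine lintegral_congr_ae ?_
    filter_upwards [hh] with x hx
    rw [hx, EReal.toENNReal_sub (EReal.coe_ennreal_nonneg _), EReal.toENNReal_coe,
      EReal.toENNReal_coe]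
  have h2 : ∫⁻ x, (-h x).toENNReal ∂μ = ∫⁻ x, (N x - P x) ∂μ := by
    refine lintegral_congr_ae ?_
    filter_upwards [hh, hNtop] with x hx hNx
    rw [hx, EReal.neg_sub (.inr (EReal.coe_ennreal_ne_bot _))
      (.inr (by simpa using hNx)), add_comm, ← sub_eq_add_neg,
      EReal.toENNReal_sub (EReal.coe_ennreal_nonneg _), EReal.toENNReal_coe, EReal.toENNReal_coe]
  have h3 : ∫⁻ x, (N x - P x) ∂μ ≤ ∫⁻ x, N x ∂μ := lintegral_mono fun x => tsub_le_self
  refine ⟨⟨?_, .inr ?_⟩, ?_⟩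
  · exact ((measurable_coe_ennreal_ereal.comp_aemeasurable hP).sub
      (measurable_coe_ennreal_ereal.comp_aemeasurable hN)).congr (hh.mono fun x hx => hx.symm)
  · rw [h2]
    exact h3.trans_lt hfin.lt_top
  · rw [extIntegral, h1, h2]
    refine coe_ennreal_sub_eq_coe_ennreal_sub ?_ (h3.trans_lt hfin.lt_top).ne hfin
    rw [← lintegral_add_right' _ hN, ← lintegral_add_left' hP]
    refine lintegral_congr fun x => ?_
    -- With truncated subtraction, (P − N) + N and (N − P) + P are both max(P, N).
    rw [tsub_add_eq_max, add_comm, tsub_add_eq_max, max_comm]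

end ExtIntegral

/-! ### The radial function of the radial mean body -/

section Body

variable {n : ℕ} (f : EuclideanSpace ℝ (Fin n) → ℝ)

/-- Each ray meets the set in all finite radii up to the prescribed one. The supremum of these
recovers the prescribed value even when it is 0 or ∞. -/
lemma radialFunction_radialMeanBody {u : EuclideanSpace ℝ (Fin n)} (hu : ‖u‖ = 1) :
    radialFunction (radialMeanBody f) u = EReal.exp (radialMeanLog f u) := by
  have key : ∀ r : ℝ≥0, (r : ℝ) • u ∈ radialMeanBody f ↔
      (r : ℝ≥0∞) ≤ EReal.exp (radialMeanLog f u) := by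
    intro r
    have hu0 : u ≠ 0 := by
      rintro rfl
      simp at hu
    rcases eq_or_ne r 0 with rfl | hr
    · simp [radialMeanBody]
    · have hr0 : (0 : ℝ) < r := by positivity
      have hnorm : ‖(r : ℝ) • u‖ = r := by
        rw [norm_smul, hu, mul_one, Real.norm_of_nonneg hr0.le]
      rw [radialMeanBody, mem_ofPred_eq, hnorm, smul_smul, inv_mul_cancel₀ hr0.ne', one_smul,
        ENNReal.ofReal_coe_nnreal]
      simp [hr, hu0]
  rw [radialFunction]
  simp_rw [key]
  refine le_antisymm (iSup₂_le fun r hr => hr) (ENNReal.le_of_forall_nnreal_lt fun r hr => ?_)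
  exact le_iSup₂ (f := fun (r : ℝ≥0) (_ : (r : ℝ≥0∞) ≤ EReal.exp (radialMeanLog f u)) =>
    (r : ℝ≥0∞)) r hr.le

lemma log_radialFunction_radialMeanBody {u : EuclideanSpace ℝ (Fin n)} (hu : ‖u‖ = 1) :
    ENNReal.log (radialFunction (radialMeanBody f) u) = radialMeanLog f u := by
  rw [radialFunction_radialMeanBody f hu, EReal.log_exp]

variable {f}

/-- `log ρ(u)` as a regularized logarithmic integral of the autocorrelation function. -/
lemma radialMeanLog_eq (hf : MemLp f 2 volume) (hf0 : 0 ≤ᵐ[volume] f)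
    (hf_ne : ¬ f =ᵐ[volume] 0) {u : EuclideanSpace ℝ (Fin n)}
    (hlo : lowerLog (fun t => autocorr f (t • u)) 1 ≠ ∞) :
    IntegralExists (volume.restrict (Ioi (0 : ℝ)))
        (fun t => (radialMeanIntegrand f u t : EReal)) ∧
      radialMeanLog f u = (upperLog (fun t => autocorr f (t • u)) 1 : EReal) -
        lowerLog (fun t => autocorr f (t • u)) 1 := by
  set c : ℝ → ℝ := fun t => autocorr f (t • u) with hc
  have hcm : Measurable c := ((continuous_autocorr hf).comp (by fun_prop)).measurable
  obtain ⟨he1, he2, he3⟩ := upperLog_exp_neg_pow one_ne_zero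
  simp only [pow_one, Nat.cast_one, div_one] at he1 he2 he3
  set e : ℝ → ℝ := fun t => Real.exp (-t) with he
  have hem : Measurable e := by fun_prop
  -- The integrand is (c − e)/t. Near the origin it is written as (1 − e)/t − (1 − c)/t, because c/t
  -- and e/t need not be integrable separately there. Then N has finite integral.
  let P : ℝ → ℝ≥0∞ := fun t => (Ioc (0 : ℝ) 1).indicator (fun t => ENNReal.ofReal ((1 - e t) / t)) t +
    (Ioi (1 : ℝ)).indicator (fun t => ENNReal.ofReal (c t / t)) t
  let N : ℝ → ℝ≥0∞ := fun t => (Ioc (0 : ℝ) 1).indicator (fun t => ENNReal.ofReal ((1 - c t) / t)) t +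
    (Ioi (1 : ℝ)).indicator (fun t => ENNReal.ofReal (e t / t)) t
  have h_int : ∀ A B : ℝ → ℝ, Measurable A → Measurable B → ∫⁻ t in Ioi (0 : ℝ),
      ((Ioc (0 : ℝ) 1).indicator (fun t => ENNReal.ofReal ((1 - A t) / t)) t +
        (Ioi (1 : ℝ)).indicator (fun t => ENNReal.ofReal (B t / t)) t) =
      lowerLog A 1 + upperLog B 1 := by
    intro A B hA hB
    rw [lintegral_add_left (Measurable.indicator (by fun_prop) measurableSet_Ioc),
      lintegral_indicator measurableSet_Ioc, lintegral_indicator measurableSet_Ioi,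
      Measure.restrict_restrict measurableSet_Ioc, Measure.restrict_restrict measurableSet_Ioi,
      inter_eq_self_of_subset_left Ioc_subset_Ioi_self,
      inter_eq_self_of_subset_left (Ioi_subset_Ioi zero_le_one), lowerLog, upperLog]
  have hPi := h_int e c hem hcm
  have hNi := h_int c e hcm hem
  have hPm : Measurable P := (Measurable.indicator (by fun_prop) measurableSet_Ioc).add
    (Measurable.indicator (by fun_prop) measurableSet_Ioi)
  have hNm : Measurable N := (Measurable.indicator (by fun_prop) measurableSet_Ioc).add
    (Measurable.indicator (by fun_prop) measurableSet_Ioi)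
  have hcoe : ∀ a b : ℝ, 0 ≤ a → 0 ≤ b →
      ((a - b : ℝ) : EReal) = (ENNReal.ofReal a : EReal) - (ENNReal.ofReal b : EReal) := by
    intro a b ha hb
    rw [EReal.coe_ennreal_ofReal, EReal.coe_ennreal_ofReal, max_eq_left ha, max_eq_left hb,
      EReal.coe_sub]
  have hpt : ∀ᵐ t ∂(volume.restrict (Ioi (0 : ℝ))),
      (radialMeanIntegrand f u t : EReal) = (P t : EReal) - N t := by
    filter_upwards [ae_restrict_mem measurableSet_Ioi] with t ht
    have ht0 : (0 : ℝ) < t := ht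
    have hI : radialMeanIntegrand f u t = c t / t - e t / t := by
      simp only [radialMeanIntegrand, hc, he, autocorr]
      ring
    have hc0 : 0 ≤ c t := autocorr_nonneg hf0 _
    have hc1 : 0 ≤ 1 - c t := sub_nonneg.2 (autocorr_le_one hf hf_ne _)
    have he0 : 0 ≤ e t := (Real.exp_pos _).le
    have he1 : 0 ≤ 1 - e t := sub_nonneg.2 (Real.exp_le_one_iff.2 (by linarith))
    rcases le_or_gt t 1 with h | h
    · have m1 : t ∈ Ioc (0 : ℝ) 1 := ⟨ht0, h⟩
      have m2 : t ∉ Ioi (1 : ℝ) := not_lt.2 h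
      simp only [P, N, indicator_of_mem m1, indicator_of_notMem m2, add_zero]
      rw [← hcoe _ _ (by positivity) (by positivity), hI]
      congr 1
      ring
    · have m1 : t ∉ Ioc (0 : ℝ) 1 := fun h' => absurd h'.2 (not_le.2 h)
      have m2 : t ∈ Ioi (1 : ℝ) := h
      simp only [P, N, indicator_of_notMem m1, indicator_of_mem m2, zero_add]
      rw [← hcoe _ _ (by positivity) (by positivity), hI]
  obtain ⟨h1, h2⟩ := extIntegral_sub hPm.aemeasurable hNm.aemeasurable
    (by rw [hNi]; exact ENNReal.add_ne_top.2 ⟨hlo, he1.ne⟩) hpt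
  refine ⟨h1, ?_⟩
  rw [radialMeanLog, h2, hPi, hNi]
  generalize upperLog c 1 = a
  generalize lowerLog c 1 = b at hlo
  generalize upperLog e 1 = p at he1 he3
  generalize lowerLog e 1 = q at he2 he3
  lift b to ℝ≥0 using hlo
  lift p to ℝ≥0 using he1.ne
  lift q to ℝ≥0 using he2.ne
  rw [ENNReal.coe_toReal, ENNReal.coe_toReal] at he3
  -- The constant −γ is the regularized integral of e^{−t}, so it cancels the subtracted
  -- exponential.
  rw [← he3]
  by_cases ha : a = ∞
  · subst ha
    rw [add_top]
    rfl
  · lift a to ℝ≥0 using ha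
    rw [← ENNReal.coe_add, ← ENNReal.coe_add]
    change (((p : ℝ) - q : ℝ) : EReal) + ((((q + a : ℝ≥0) : ℝ) : EReal) -
      (((b + p : ℝ≥0) : ℝ) : EReal)) = ((a : ℝ) : EReal) - ((b : ℝ) : EReal)
    rw [← EReal.coe_sub, ← EReal.coe_sub, ← EReal.coe_add]
    congr 1
    push_cast
    ring

end Body

/-! ### The Gagliardo integral and integrability near the origin -/

section Gagliardo

variable {n : ℕ} {f : EuclideanSpace ℝ (Fin n) → ℝ}

lemma lintegral_sub_translate_sq (hf : MemLp f 2 volume) (hf_ne : ¬ f =ᵐ[volume] 0)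
    (z : EuclideanSpace ℝ (Fin n)) :
    ∫⁻ x, ENNReal.ofReal (|f x - f (x + z)| ^ 2) =
      ENNReal.ofReal (2 * l2NormSq f * (1 - autocorr f z)) := by
  have hfz : MemLp (fun x => f (x + z)) 2 volume :=
    hf.comp_measurePreserving (measurePreserving_add_right_volume z)
  have hi := (hf.sub hfz).integrable_sq
  simp only [Pi.sub_apply] at hi
  simp_rw [sq_abs]
  rw [← ofReal_integral_eq_lintegral_ofReal hi (.of_forall fun x => sq_nonneg _)]
  congr 1
  have hm : Integrable fun x => f x * f (x + z) := hf.integrable_mul hfz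
  have : ∀ x, (f x - f (x + z)) ^ 2 = f x ^ 2 + f (x + z) ^ 2 - 2 * (f x * f (x + z)) := by
    intro x; ring
  simp_rw [this]
  rw [integral_sub (f := fun x => f x ^ 2 + f (x + z) ^ 2)
      (hf.integrable_sq.add hfz.integrable_sq) (hm.const_mul 2),
    integral_add hf.integrable_sq hfz.integrable_sq, integral_const_mul,
    integral_add_right_eq_self (fun x => f x ^ 2) z, ← l2NormSq, autocorr]
  have := (l2NormSq_pos hf hf_ne).ne'
  field_simp
  ring

/-- Substitute y = x + z and integrate in x first: the expanded square then gives ‖f(·) − f(· +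
z)‖₂² = 2‖f‖₂²(1 − c(z)). -/
lemma gagliardo_eq (hf : MemLp f 2 volume) (hf_ne : ¬ f =ᵐ[volume] 0) (s : ℝ) :
    ∫⁻ x, ∫⁻ y, ENNReal.ofReal (|f x - f y| ^ 2 / ‖x - y‖ ^ s) =
      ∫⁻ z : EuclideanSpace ℝ (Fin n),
        ENNReal.ofReal (2 * l2NormSq f * (1 - autocorr f z) / ‖z‖ ^ s) := by
  have h1 : ∀ x, ∫⁻ y, ENNReal.ofReal (|f x - f y| ^ 2 / ‖x - y‖ ^ s) =
      ∫⁻ z, ENNReal.ofReal (|f x - f (x + z)| ^ 2 / ‖z‖ ^ s) := by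
    intro x
    rw [← lintegral_add_left_eq_self _ x]
    simp
  simp_rw [h1]
  rw [lintegral_lintegral_swap]
  · refine lintegral_congr fun z => ?_
    have h2 : ∀ x, ENNReal.ofReal (|f x - f (x + z)| ^ 2 / ‖z‖ ^ s) =
        ENNReal.ofReal (|f x - f (x + z)| ^ 2) * ENNReal.ofReal (‖z‖ ^ s)⁻¹ := by
      intro x
      rw [← ENNReal.ofReal_mul (by positivity), div_eq_mul_inv]
    simp_rw [h2]
    rw [lintegral_mul_const' _ _ ENNReal.ofReal_ne_top, lintegral_sub_translate_sq hf hf_ne,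
      ← ENNReal.ofReal_mul, div_eq_mul_inv]
    exact mul_nonneg (mul_nonneg two_pos.le (l2NormSq_pos hf hf_ne).le)
      (sub_nonneg.2 (autocorr_le_one hf hf_ne z))
  · have hfm := hf.aestronglyMeasurable.aemeasurable
    have m1 : AEMeasurable (fun p : EuclideanSpace ℝ (Fin n) × EuclideanSpace ℝ (Fin n) => f p.1)
        (volume.prod volume) := hfm.comp_quasiMeasurePreserving Measure.quasiMeasurePreserving_fst
    have m2 : AEMeasurable (fun p : EuclideanSpace ℝ (Fin n) × EuclideanSpace ℝ (Fin n) =>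
        f (p.1 + p.2)) (volume.prod volume) :=
      hfm.comp_quasiMeasurePreserving (Measure.quasiMeasurePreserving_snd.comp
        (measurePreserving_prod_add volume volume).quasiMeasurePreserving)
    exact (((m1.sub m2).norm.pow_const 2).div
      ((measurable_snd.norm.pow_const s).aemeasurable)).ennreal_ofReal

/-- For `f` in a fractional Sobolev space the singular part of the logarithmic integrals of the
autocorrelation function is integrable over the directions. -/
lemma lintegral_lowerLog_autocorr_lt_top (hn : 1 ≤ n) {β : ℝ} (hβ : 0 < β)
    (hf : MemFracSobolev β f) (hf_ne : ¬ f =ᵐ[volume] 0) :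
    ∫⁻ u : Metric.sphere (0 : EuclideanSpace ℝ (Fin n)) 1,
      lowerLog (fun t => autocorr f (t • (u : EuclideanSpace ℝ (Fin n)))) 1
        ∂(volume : Measure (EuclideanSpace ℝ (Fin n))).toSphere < ∞ := by
  have hl := l2NormSq_pos hf.memLp hf_ne
  have hg := hf.gagliardo_lt_top
  have hcm : Measurable (autocorr f) := (continuous_autocorr hf.memLp).measurable
  rw [gagliardo_eq hf.memLp hf_ne, lintegral_polar hn (by fun_prop)] at hg
  have hC : ENNReal.ofReal (1 / (2 * l2NormSq f)) < ∞ := ENNReal.ofReal_lt_top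
  refine lt_of_le_of_lt ?_ (ENNReal.mul_lt_top hC hg)
  rw [← lintegral_const_mul' _ _ hC.ne]
  refine lintegral_mono fun u => ?_
  rw [← lintegral_const_mul' _ _ hC.ne, lowerLog]
  refine (setLIntegral_mono' measurableSet_Ioc fun t ht => ?_).trans
    (lintegral_mono_set Ioc_subset_Ioi_self)
  have ht0 : 0 < t := ht.1
  have hu : ‖t • (u : EuclideanSpace ℝ (Fin n))‖ = t := by
    rw [norm_smul, Real.norm_of_nonneg ht0.le]
    simp
  have hc1 : 0 ≤ 1 - autocorr f (t • (u : EuclideanSpace ℝ (Fin n))) :=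
    sub_nonneg.2 (autocorr_le_one hf.memLp hf_ne _)
  rw [hu, ← ENNReal.ofReal_mul (by positivity), ← ENNReal.ofReal_mul (by positivity)]
  refine ENNReal.ofReal_le_ofReal ?_
  -- The Jacobian t^{n−1} cancels and leaves the weight t^{−1−2β}, which dominates 1/t on (0, 1].
  have e1 : t ^ ((n : ℝ) + 2 * β) = t ^ (n - 1) * t * t ^ (2 * β) := by
    rw [Real.rpow_add ht0, Real.rpow_natCast, ← pow_succ, Nat.sub_add_cancel hn]
  have e2 : t ^ (2 * β) ≤ 1 := Real.rpow_le_one ht0.le ht.2 (by positivity)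
  have e3 : 0 < t ^ (2 * β) := Real.rpow_pos_of_pos ht0 _
  have e4 : 1 / (2 * l2NormSq f) * (t ^ (n - 1) * (2 * l2NormSq f *
      (1 - autocorr f (t • (u : EuclideanSpace ℝ (Fin n)))) / t ^ ((n : ℝ) + 2 * β))) =
      (1 - autocorr f (t • (u : EuclideanSpace ℝ (Fin n)))) / (t * t ^ (2 * β)) := by
    rw [e1]
    field_simp
  rw [e4]
  gcongr
  exact mul_le_of_le_one_right ht0.le e2

end Gagliardo

/-- For t > 1 one has exp(t²) ≥ 1 + t² ≥ 2, so 1/t ≤ 2(1 − exp(−t²))/t. Averaged over the spectral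
measure, this bounds E log⁺|ξ|. -/
lemma ofReal_log_le_lowerLog_exp_neg_sq (r : ℝ) :
    ENNReal.ofReal (Real.log r) ≤ 2 * lowerLog (fun t => Real.exp (-t ^ 2)) |r| := by
  rw [← Real.log_abs]
  rcases le_total |r| 1 with h | h
  · rw [ENNReal.ofReal_of_nonpos (Real.log_nonpos (abs_nonneg r) h)]
    exact zero_le
  · have h1 := lintegral_inv_Ioc one_pos h
    rw [div_one] at h1
    rw [← h1, lowerLog, ← lintegral_const_mul' _ _ ENNReal.ofNat_ne_top]
    refine (setLIntegral_mono' measurableSet_Ioc fun t ht => ?_).trans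
      (lintegral_mono_set (Ioc_subset_Ioc_left zero_le_one))
    have ht1 : 1 < t := ht.1
    have ht0 : 0 < t := one_pos.trans ht1
    rw [← ENNReal.ofReal_ofNat, ← ENNReal.ofReal_mul zero_le_two]
    refine ENNReal.ofReal_le_ofReal ?_
    have e1 : Real.exp (-t ^ 2) ≤ 1 / 2 := by
      have h2 : (2 : ℝ) ≤ Real.exp (t ^ 2) := by
        have := Real.add_one_le_exp (t ^ 2)
        nlinarith
      rw [Real.exp_neg, one_div]
      exact inv_anti₀ two_pos h2
    rw [← mul_div_assoc]
    gcongr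
    linarith

/-! ### The spectral measure and the comparison of the two mixtures -/

section Spectral

variable {n : ℕ} {f : EuclideanSpace ℝ (Fin n) → ℝ}

/-- The probability measure with density `|f̂|² / ‖f‖₂²`. -/
noncomputable def spectralMeasure (f : EuclideanSpace ℝ (Fin n) → ℝ) (hf : MemLp f 2 volume) :
    Measure (EuclideanSpace ℝ (Fin n)) :=
  volume.withDensity fun ξ => ENNReal.ofReal (spectralDensity f hf ξ)

lemma isProbabilityMeasure_spectralMeasure (hf : MemLp f 2 volume) (hf_ne : ¬ f =ᵐ[volume] 0) :
    IsProbabilityMeasure (spectralMeasure f hf) :=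
  isProbabilityMeasure_withDensity_ofReal (spectralDensity_nonneg hf)
    (integrable_spectralDensity hf) (integral_spectralDensity hf hf_ne)

lemma spectralMeasure_ae_norm_pos (hn : 1 ≤ n) (hf : MemLp f 2 volume) :
    ∀ᵐ ξ ∂(spectralMeasure f hf), 0 < ‖ξ‖ := by
  have : Nonempty (Fin n) := ⟨⟨0, hn⟩⟩
  have h : ∀ᵐ x : EuclideanSpace ℝ (Fin n), 0 < ‖x‖ := by
    filter_upwards [compl_mem_ae_iff.2 (measure_singleton (0 : EuclideanSpace ℝ (Fin n)))] with x hx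
    exact norm_pos_iff.2 hx
  exact (withDensity_absolutelyContinuous _ _).ae_le h

lemma lintegral_fourierL2_sq_mul (hf : MemLp f 2 volume) (hf_ne : ¬ f =ᵐ[volume] 0)
    {F : EuclideanSpace ℝ (Fin n) → ℝ} (hF : Measurable F) :
    ∫⁻ ξ, ENNReal.ofReal (‖fourierL2 f hf ξ‖ ^ 2 * F ξ) =
      ENNReal.ofReal (l2NormSq f) * ∫⁻ ξ, ENNReal.ofReal (F ξ) ∂(spectralMeasure f hf) := by
  have hl := l2NormSq_pos hf hf_ne
  rw [spectralMeasure, lintegral_withDensity_eq_lintegral_mul _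
    (measurable_spectralDensity hf).ennreal_ofReal hF.ennreal_ofReal,
    ← lintegral_const_mul' _ _ ENNReal.ofReal_ne_top]
  refine lintegral_congr fun ξ => ?_
  rw [Pi.mul_apply, ← mul_assoc, ← ENNReal.ofReal_mul hl.le,
    ← ENNReal.ofReal_mul (mul_nonneg hl.le (spectralDensity_nonneg hf ξ)), spectralDensity,
    ← mul_assoc, mul_one_div_cancel hl.ne', one_mul]

/-- The spherical mean of the regularized logarithmic integrals of the autocorrelation function,
compared with the logarithmic moment of the spectral measure. -/
lemma autocorr_log_identity (hn : 1 ≤ n) (hf : MemLp f 2 volume) (hf0 : 0 ≤ᵐ[volume] f)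
    (hf_ne : ¬ f =ᵐ[volume] 0)
    (hlo : ∫⁻ x, lowerLog (fun t => autocorr f (t • ‖x‖⁻¹ • x)) 1 ∂(gaussMeasure n) < ∞) :
    ∫⁻ ξ, ENNReal.ofReal (Real.log ‖ξ‖) ∂(spectralMeasure f hf) < ∞ ∧
    ∃ a b : ℝ≥0, (a : ℝ) - b =
        Real.log Real.pi - 1 / 2 * (digamma (n / 2) + digamma 1) ∧
      ∫⁻ x, upperLog (fun t => autocorr f (t • ‖x‖⁻¹ • x)) 1 ∂(gaussMeasure n) +
          ∫⁻ ξ, ENNReal.ofReal (Real.log ‖ξ‖) ∂(spectralMeasure f hf) + a =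
        ∫⁻ x, lowerLog (fun t => autocorr f (t • ‖x‖⁻¹ • x)) 1 ∂(gaussMeasure n) +
          ∫⁻ ξ, ENNReal.ofReal (-Real.log ‖ξ‖) ∂(spectralMeasure f hf) + b := by
  have := isProbabilityMeasure_spectralMeasure hf hf_ne
  have hcm : Measurable (autocorr f) := (continuous_autocorr hf).measurable
  -- The common function: a mixture of exp(−t²) with scale ‖ξ‖, and also a mixture of the
  -- autocorrelation along rays with scale ‖x‖.
  let H : ℝ → ℝ := fun t => ∫ ξ, Real.exp (-(t * ‖ξ‖) ^ 2) ∂(spectralMeasure f hf)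
  have hB₁ : Measurable (Function.uncurry fun (x : EuclideanSpace ℝ (Fin n)) (t : ℝ) =>
      autocorr f (t • ‖x‖⁻¹ • x)) := by
    simp only [Function.uncurry_def]
    fun_prop
  have hB₂ : Measurable (Function.uncurry fun (_ : EuclideanSpace ℝ (Fin n)) (t : ℝ) =>
      Real.exp (-t ^ 2)) := by
    simp only [Function.uncurry_def]
    fun_prop
  have h01₁ : ∀ (x : EuclideanSpace ℝ (Fin n)) (t : ℝ), 0 < t →
      autocorr f (t • ‖x‖⁻¹ • x) ∈ Icc (0 : ℝ) 1 :=
    fun x t _ => ⟨autocorr_nonneg hf0 _, autocorr_le_one hf hf_ne _⟩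
  have h01₂ : ∀ (_ : EuclideanSpace ℝ (Fin n)) (t : ℝ), 0 < t →
      Real.exp (-t ^ 2) ∈ Icc (0 : ℝ) 1 :=
    fun _ t _ => ⟨(Real.exp_pos _).le, Real.exp_le_one_iff.2 (by nlinarith)⟩
  have hH₁ : ∀ t, 0 < t → H t = ∫ x, autocorr f ((t * ‖x‖) • ‖x‖⁻¹ • x) ∂(gaussMeasure n) := by
    intro t _
    have : ∀ x : EuclideanSpace ℝ (Fin n), (t * ‖x‖) • ‖x‖⁻¹ • x = t • x := by
      intro x
      rcases eq_or_ne x 0 with rfl | hx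
      · simp
      · rw [smul_smul, mul_assoc, mul_inv_cancel₀ (norm_ne_zero_iff.2 hx), mul_one]
    simp_rw [this]
    rw [integral_autocorr_gaussMeasure hf, ← integral_withDensity_ofReal
      (measurable_spectralDensity hf) (spectralDensity_nonneg hf), ← spectralMeasure]
  have hH₂ : ∀ t, 0 < t → H t = ∫ ξ, Real.exp (-(t * ‖ξ‖) ^ 2) ∂(spectralMeasure f hf) :=
    fun _ _ => rfl
  obtain ⟨hRi, hRv⟩ := gaussMeasure_log_norm hn
  have hR1 := hRi.lintegral_lt_top
  have hR2 : ∫⁻ x, ENNReal.ofReal (-Real.log ‖x‖) ∂(gaussMeasure n) < ∞ :=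
    hRi.neg.lintegral_lt_top
  rw [integral_eq_lintegral_pos_part_sub_lintegral_neg_part hRi] at hRv
  have hpos₁ := gaussMeasure_ae_norm_pos hn
  have hpos₂ := spectralMeasure_ae_norm_pos hn hf
  have hmix₁ := upperLog_mixture hB₁ h01₁ measurable_norm hpos₁ hH₁
  have hHlo := lowerLog_mixture_lt_top hB₁ h01₁ measurable_norm hpos₁ hH₁ hlo hR1
  have hmix₂ := upperLog_mixture hB₂ h01₂ measurable_norm hpos₂ hH₂
  obtain ⟨hg1, hg2, hg3⟩ := upperLog_exp_neg_pow two_ne_zero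
  have hX : ∫⁻ ξ, ENNReal.ofReal (Real.log ‖ξ‖) ∂(spectralMeasure f hf) < ∞ := by
    have h2 := lowerLog_average hB₂ h01₂ measurable_norm hpos₂ hH₂
    refine lt_of_le_of_lt (lintegral_mono fun ξ => ofReal_log_le_lowerLog_exp_neg_sq ‖ξ‖) ?_
    simp_rw [abs_norm]
    rw [lintegral_const_mul' _ _ ENNReal.ofNat_ne_top, ← h2]
    exact ENNReal.mul_lt_top ENNReal.ofNat_lt_top hHlo
  refine ⟨hX, ?_⟩
  simp only [lintegral_const, measure_univ, mul_one] at hmix₂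
  rw [digamma_one]
  generalize upperLog (fun t => Real.exp (-t ^ 2)) 1 = g₁ at *
  generalize lowerLog (fun t => Real.exp (-t ^ 2)) 1 = g₂ at *
  generalize ∫⁻ x, upperLog (fun t => autocorr f (t • ‖x‖⁻¹ • x)) 1 ∂(gaussMeasure n) = U at *
  generalize ∫⁻ x, lowerLog (fun t => autocorr f (t • ‖x‖⁻¹ • x)) 1 ∂(gaussMeasure n) = L at *
  generalize ∫⁻ ξ, ENNReal.ofReal (Real.log ‖ξ‖) ∂(spectralMeasure f hf) = X₁ at *
  generalize ∫⁻ ξ, ENNReal.ofReal (-Real.log ‖ξ‖) ∂(spectralMeasure f hf) = X₂ at *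
  generalize ∫⁻ x, ENNReal.ofReal (Real.log ‖x‖) ∂(gaussMeasure n) = R₁ at *
  generalize ∫⁻ x, ENNReal.ofReal (-Real.log ‖x‖) ∂(gaussMeasure n) = R₂ at *
  generalize upperLog H 1 = h₁ at *
  generalize lowerLog H 1 = h₂ at *
  lift g₁ to ℝ≥0 using hg1.ne
  lift g₂ to ℝ≥0 using hg2.ne
  lift R₁ to ℝ≥0 using hR1.ne
  lift R₂ to ℝ≥0 using hR2.ne
  rw [ENNReal.coe_toReal, ENNReal.coe_toReal] at hRv hg3
  -- The difference of the witnesses is −J(exp(−t²)) − E log|x| = γ/2 − (ψ(n/2)/2 − log π).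
  refine ⟨g₂ + R₂, g₁ + R₁, ?_, ?_⟩
  · push_cast at hg3 ⊢
    linarith
  -- If h₁, the part of H over (1, ∞), is infinite, then both U and X₂ are infinite. Otherwise the
  -- two mixture identities, one of them reversed, are added and h₁ + h₂ is cancelled.
  · by_cases htop : h₁ = ∞
    · subst htop
      have hU : U = ∞ := by
        by_contra hU
        simp only [top_add] at hmix₁
        exact ENNReal.add_ne_top.2 ⟨ENNReal.add_ne_top.2 ⟨hU, hHlo.ne⟩, ENNReal.coe_ne_top⟩
          hmix₁.symm
      have hX₂ : X₂ = ∞ := by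
        by_contra hX₂
        simp only [top_add] at hmix₂
        exact ENNReal.add_ne_top.2 ⟨ENNReal.add_ne_top.2 ⟨ENNReal.coe_ne_top, hHlo.ne⟩, hX₂⟩
          hmix₂.symm
      simp [hU, hX₂]
    · have hfin : h₁ + h₂ ≠ ∞ := ENNReal.add_ne_top.2 ⟨htop, hHlo.ne⟩
      have hsum := congrArg₂ (· + ·) hmix₁.symm hmix₂
      refine (ENNReal.add_right_inj hfin).1 ?_
      push_cast
      calc _ = U + h₂ + R₂ + (h₁ + g₂ + X₁) := by ring
        _ = h₁ + L + R₁ + (g₁ + h₂ + X₂) := hsum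
        _ = _ := by ring

end Spectral

/-- Passage from the additive identity in [0,∞] to the stated one in [−∞,∞). As L and X₁ are finite,
U and X₂ are infinite together, and then both sides are −∞. -/
lemma coe_ennreal_neg_mul_sub_eq {U L X₁ X₂ : ℝ≥0∞} {s l : ℝ} {a b : ℝ≥0} (hs : 0 < s)
    (hl : 0 < l) (hL : L ≠ ∞) (hX : X₁ ≠ ∞) (h : U + X₁ + a = L + X₂ + b) :
    ((-(1 / s) : ℝ) : EReal) *
        (((ENNReal.ofReal s * U : ℝ≥0∞) : EReal) - ((ENNReal.ofReal s * L : ℝ≥0∞) : EReal)) =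
      ((1 / l : ℝ) : EReal) * (((ENNReal.ofReal l * X₁ : ℝ≥0∞) : EReal) -
        ((ENNReal.ofReal l * X₂ : ℝ≥0∞) : EReal)) + (((a : ℝ) - b : ℝ) : EReal) := by
  lift L to ℝ≥0 using hL
  lift X₁ to ℝ≥0 using hX
  lift s to ℝ≥0 using hs.le
  lift l to ℝ≥0 using hl.le
  rw [ENNReal.ofReal_coe_nnreal, ENNReal.ofReal_coe_nnreal]
  have hs' : s ≠ 0 := by rintro rfl; simp at hs
  have hl' : l ≠ 0 := by rintro rfl; simp at hl
  by_cases hU : U = ∞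
  · have hX₂ : X₂ = ∞ := by
      by_contra hX₂
      rw [hU, top_add, top_add] at h
      exact ENNReal.add_ne_top.2 ⟨ENNReal.add_ne_top.2 ⟨ENNReal.coe_ne_top, hX₂⟩,
        ENNReal.coe_ne_top⟩ h.symm
    have h1 : (s : ℝ≥0∞) * U = ∞ := by rw [hU]; exact ENNReal.mul_top (by exact_mod_cast hs')
    have h2 : (l : ℝ≥0∞) * X₂ = ∞ := by rw [hX₂]; exact ENNReal.mul_top (by exact_mod_cast hl')
    rw [h1, h2, ← ENNReal.coe_mul, ← ENNReal.coe_mul, EReal.coe_ennreal_top]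
    change _ * (⊤ - (((s * L : ℝ≥0) : ℝ) : EReal)) =
      _ * ((((l * X₁ : ℝ≥0) : ℝ) : EReal) - ⊤) + _
    rw [EReal.top_sub_coe, sub_eq_add_neg _ ⊤, EReal.neg_top, EReal.add_bot,
      EReal.coe_mul_top_of_neg, EReal.coe_mul_bot_of_pos, EReal.bot_add]
    · positivity
    · simpa using hs
  · have hX₂ : X₂ ≠ ∞ := by
      rintro rfl
      rw [add_top, top_add] at h
      exact ENNReal.add_ne_top.2 ⟨ENNReal.add_ne_top.2 ⟨hU, ENNReal.coe_ne_top⟩,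
        ENNReal.coe_ne_top⟩ h
    lift U to ℝ≥0 using hU
    lift X₂ to ℝ≥0 using hX₂
    have h' : (U : ℝ) + X₁ + a = L + X₂ + b := by exact_mod_cast h
    simp only [← ENNReal.coe_mul]
    change _ * ((((s * U : ℝ≥0) : ℝ) : EReal) - (((s * L : ℝ≥0) : ℝ) : EReal)) =
      _ * ((((l * X₁ : ℝ≥0) : ℝ) : EReal) - (((l * X₂ : ℝ≥0) : ℝ) : EReal)) + _
    simp only [← EReal.coe_sub, ← EReal.coe_mul, ← EReal.coe_add]
    congr 1
    push_cast
    field_simp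
    linarith

end RadialMean

/-! ### The main theorem -/

theorem proposition4 (n : ℕ) (hn : 1 ≤ n) (β : ℝ) (hβ : β ∈ Set.Ioo (0 : ℝ) (1 / 2))
    (f : EuclideanSpace ℝ (Fin n) → ℝ) (hf : RadialMean.MemFracSobolev β f)
    (hf_nonneg : 0 ≤ᵐ[volume] f) (hf_ne : ¬ f =ᵐ[volume] 0) :
    -- the integral that defines `log ρ` exists for almost all directions
    (∀ᵐ u : Metric.sphere (0 : EuclideanSpace ℝ (Fin n)) 1
        ∂(volume : Measure (EuclideanSpace ℝ (Fin n))).toSphere,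
      RadialMean.IntegralExists (volume.restrict (Ioi (0 : ℝ)))
        (fun t => (RadialMean.radialMeanIntegrand f u t : EReal))) ∧
    -- both integrals in the identity exist, and the one on the Fourier side is not `+∞`
    RadialMean.IntegralExists (volume : Measure (EuclideanSpace ℝ (Fin n))).toSphere
      (fun u => ENNReal.log (RadialMean.radialFunction (RadialMean.radialMeanBody f) u)) ∧
    RadialMean.IntegralExists (volume : Measure (EuclideanSpace ℝ (Fin n)))
      (fun ξ => ((‖RadialMean.fourierL2 f hf.memLp ξ‖ ^ 2 * Real.log ‖ξ‖ : ℝ) : EReal)) ∧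
    RadialMean.extIntegral (volume : Measure (EuclideanSpace ℝ (Fin n)))
      (fun ξ => ((‖RadialMean.fourierL2 f hf.memLp ξ‖ ^ 2 * Real.log ‖ξ‖ : ℝ) : EReal)) < ⊤ ∧
    -- the identity in `[-∞, ∞)`
    ((-(1 / (n * RadialMean.unitBallVolume n)) : ℝ) : EReal) *
        RadialMean.extIntegral (volume : Measure (EuclideanSpace ℝ (Fin n))).toSphere
          (fun u => ENNReal.log (RadialMean.radialFunction (RadialMean.radialMeanBody f) u)) =
      ((1 / RadialMean.l2NormSq f : ℝ) : EReal) *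
          RadialMean.extIntegral (volume : Measure (EuclideanSpace ℝ (Fin n)))
            (fun ξ => ((‖RadialMean.fourierL2 f hf.memLp ξ‖ ^ 2 * Real.log ‖ξ‖ : ℝ) : EReal)) +
        ((Real.log Real.pi -
          1 / 2 * (RadialMean.digamma (n / 2) + RadialMean.digamma 1) : ℝ) : EReal) := by
  open RadialMean in
  have hf2 := hf.memLp
  have hcm : Measurable (autocorr f) := (continuous_autocorr hf2).measurable
  have hl := l2NormSq_pos hf2 hf_ne
  have hs : 0 < (n : ℝ) * unitBallVolume n := by
    have : 0 < volume (Metric.ball (0 : EuclideanSpace ℝ (Fin n)) 1) :=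
      Metric.measure_ball_pos _ _ one_pos
    have h2 : 0 < unitBallVolume n := ENNReal.toReal_pos this.ne' measure_ball_lt_top.ne
    have h3 : (0 : ℝ) < n := by exact_mod_cast hn
    positivity
  have hBm : Measurable (Function.uncurry fun (y : EuclideanSpace ℝ (Fin n)) (t : ℝ) =>
      autocorr f (t • y)) := by
    simp only [Function.uncurry_def]
    fun_prop
  have hUm := measurable_upperLog hBm (r := fun _ => 1) measurable_const
  have hLm := measurable_lowerLog hBm (r := fun _ => 1) measurable_const
  have hlo := lintegral_lowerLog_autocorr_lt_top hn hβ.1 hf hf_ne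
  have hae : ∀ᵐ u : Metric.sphere (0 : EuclideanSpace ℝ (Fin n)) 1
      ∂(volume : Measure (EuclideanSpace ℝ (Fin n))).toSphere,
      lowerLog (fun t => autocorr f (t • (u : EuclideanSpace ℝ (Fin n)))) 1 ≠ ∞ :=
    (ae_lt_top (hLm.comp measurable_subtype_coe) hlo.ne).mono fun u hu => hu.ne
  obtain ⟨hex, hval⟩ := extIntegral_sub (μ := (volume : Measure (EuclideanSpace ℝ (Fin n))).toSphere)
    (h := fun u => ENNReal.log (radialFunction (radialMeanBody f) u))
    (hUm.comp measurable_subtype_coe).aemeasurable (hLm.comp measurable_subtype_coe).aemeasurable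
    hlo.ne (by
      filter_upwards [hae] with u hu
      rw [log_radialFunction_radialMeanBody f (by simp)]
      exact (radialMeanLog_eq hf2 hf_nonneg hf_ne hu).2)
  have hU := lintegral_gaussMeasure_angular hn hUm
  have hL := lintegral_gaussMeasure_angular hn hLm
  -- The Gaussian mean is the spherical integral divided by the positive number nω_n, so finiteness
  -- carries over.
  have hlo' : ∫⁻ x, lowerLog (fun t => autocorr f (t • ‖x‖⁻¹ • x)) 1 ∂(gaussMeasure n) < ∞ := by
    by_contra! htop
    rw [top_le_iff.1 htop, ENNReal.mul_top (ENNReal.ofReal_pos.2 hs).ne'] at hL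
    exact hlo.ne hL.symm
  obtain ⟨hX, a, b, hab, hid⟩ := autocorr_log_identity hn hf2 hf_nonneg hf_ne hlo'
  have hX₁ := lintegral_fourierL2_sq_mul hf2 hf_ne (F := fun ξ => Real.log ‖ξ‖) (by fun_prop)
  have hX₂ := lintegral_fourierL2_sq_mul hf2 hf_ne (F := fun ξ => -Real.log ‖ξ‖) (by fun_prop)
  have hXtop : ENNReal.ofReal (l2NormSq f) *
      ∫⁻ ξ, ENNReal.ofReal (Real.log ‖ξ‖) ∂(spectralMeasure f hf2) < ∞ :=
    ENNReal.mul_lt_top ENNReal.ofReal_lt_top hX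
  have hXval : extIntegral (volume : Measure (EuclideanSpace ℝ (Fin n)))
      (fun ξ => ((‖fourierL2 f hf.memLp ξ‖ ^ 2 * Real.log ‖ξ‖ : ℝ) : EReal)) =
      ((ENNReal.ofReal (l2NormSq f) *
        ∫⁻ ξ, ENNReal.ofReal (Real.log ‖ξ‖) ∂(spectralMeasure f hf2) : ℝ≥0∞) : EReal) -
      ((ENNReal.ofReal (l2NormSq f) *
        ∫⁻ ξ, ENNReal.ofReal (-Real.log ‖ξ‖) ∂(spectralMeasure f hf2) : ℝ≥0∞) : EReal) := by
    rw [extIntegral, ← hX₁, ← hX₂]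
    simp_rw [← EReal.coe_neg, EReal.real_coe_toENNReal, mul_neg]
  refine ⟨?_, hex, ⟨?_, .inl ?_⟩, ?_, ?_⟩
  · filter_upwards [hae] with u hu
    exact (radialMeanLog_eq hf2 hf_nonneg hf_ne hu).1
  · refine (measurable_coe_real_ereal.comp ?_).aemeasurable
    exact ((Lp.stronglyMeasurable (fourierL2 f hf2)).measurable.norm.pow_const 2).mul (by fun_prop)
  · simp_rw [EReal.real_coe_toENNReal]
    rw [hX₁]
    exact hXtop
  · rw [hXval]
    refine lt_of_le_of_lt ((EReal.sub_le_sub le_rfl (EReal.coe_ennreal_nonneg _)).trans_eq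
      (sub_zero _)) ?_
    exact lt_top_iff_ne_top.2 (EReal.coe_ennreal_eq_top_iff.not.2 hXtop.ne)
  · rw [hXval, hval, ← hab]
    change ((-(1 / (n * unitBallVolume n)) : ℝ) : EReal) *
      (((∫⁻ u : Metric.sphere (0 : EuclideanSpace ℝ (Fin n)) 1,
          upperLog (fun t => autocorr f (t • (u : EuclideanSpace ℝ (Fin n)))) 1
          ∂(volume : Measure (EuclideanSpace ℝ (Fin n))).toSphere : ℝ≥0∞) : EReal) -
        ((∫⁻ u : Metric.sphere (0 : EuclideanSpace ℝ (Fin n)) 1,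
          lowerLog (fun t => autocorr f (t • (u : EuclideanSpace ℝ (Fin n)))) 1
          ∂(volume : Measure (EuclideanSpace ℝ (Fin n))).toSphere : ℝ≥0∞) : EReal)) = _
    rw [← hU, ← hL]
    exact coe_ennreal_neg_mul_sub_eq hs hl hlo'.ne hX.ne hid
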